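/- Let $P_0,P_1$ be probability distributions on $\mathbb{R}^D$ with mean vectors $\mu_0,\mu_1$, the same nonsingular covariance matrix $\Sigma$, and finite third moments $\int\|x\|_2^3\,dP_j(x)<\infty$ ($j=0,1$). Under separate sampling, let $X_{1,0},\dots,X_{n_0,0}\sim P_0$ and $X_{1,1},\dots,X_{n_1,1}\sim P_1$, all of them mutually independent, where the sample sizes $n_0,n_1$ are deterministic, $n=n_0+n_1\to\infty$, and $n_1/n$ converges to a constant in $(0,1)$ (for instance, is a fixed constant in $(0,1)$). Let $X_1,\dots,X_n$ be the pooled sample, $\pi_0=n_0/n$, $\pi_1=n_1/n$, let $\widehat\mu_0,\widehat\mu_1,\widehat\mu$ be the sample means of the first, the second and the pooled sample, and put \[ \mathcal{S}=\frac1n\sum_{i=1}^n(X_i-\widehat\mu)(X_i-\widehat\mu)^\top,\qquad \mathcal{S}_p=\frac{1}{n_0+n_1-2}\sum_{j=0}^{1}\sum_{i=1}^{n_j}(X_{i,j}-\widehat\mu_j)(X_{i,j}-\widehat\mu_j)^\top , \] \[ \widehat m_{\mathrm{LDA}}(x)=\frac{\pi_1\exp\{-\frac12(x-\widehat\mu_1)^\top\mathcal{S}^{-1}(x-\widehat\mu_1)\}}{\pi_0\exp\{-\frac12(x-\widehat\mu_0)^\top\mathcal{S}^{-1}(x-\widehat\mu_0)\}+\pi_1\exp\{-\frac12(x-\widehat\mu_1)^\top\mathcal{S}^{-1}(x-\widehat\mu_1)\}},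 \] \[ \widehat{\mathcal{T}}_{\mathrm{LDA}}=\frac1n\sum_{i=1}^n\big(\widehat m_{\mathrm{LDA}}(X_i)-\pi_1\big)^2,\qquad T^2_{\mathrm{Hotelling}}=\frac{n_0n_1}{n_0+n_1}(\widehat\mu_0-\widehat\mu_1)^\top\mathcal{S}_p^{-1}(\widehat\mu_0-\widehat\mu_1). \] Suppose that $\mathcal{S}_p^{-1}=\Sigma^{-1}(1+o_P(1))$ and $\mathcal{S}^{-1}=\Sigma^{-1}(1+o_P(1))$, where $1$ is the identity matrix and $o_P(1)$ stands for a random matrix whose entries converge to $0$ in probability. Then, under $H_0:\mu_0=\mu_1$, \[ n\widehat{\mathcal{T}}_{\mathrm{LDA}}=n\pi_0^2\pi_1^2(\widehat\mu_0-\widehat\mu_1)^\top\mathcal{S}_p^{-1}(\widehat\mu_0-\widehat\mu_1)+o_P(1). \] Moreover, \[ n\pi_0^{-1}\pi_1^{-1}\widehat{\mathcal{T}}_{\mathrm{LDA}}=T^2_{\mathrm{Hotelling}}+o_P(1), \] and both $n\pi_0^{-1}\pi_1^{-1}\widehat{\mathcal{T}}_{\mathrm{LDA}}$ and $T^2_{\mathrm{Hotelling}}$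 converge in distribution to $\chi^2_D$, the chi-squared distribution with $D$ degrees of freedom. -/

import Mathlib

open MeasureTheory ProbabilityTheory Filter
open scoped Topology Matrix

noncomputable section

namespace LDATwoSample

/-- The feature space `ℝ^D` with its Euclidean norm. -/
abbrev Vec (D : ℕ) : Type := EuclideanSpace ℝ (Fin D)

/-! ### Population quantities -/

/-- The covariance matrix of a probability distribution on `ℝ^D`. -/
def covMatrix {D : ℕ} (P : Measure (Vec D)) : Matrix (Fin D) (Fin D) ℝ :=
  Matrix.of fun i j => cov[fun x : Vec D => x i, fun x : Vec D => x j; P]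

/-- The chi-squared distribution with `D` degrees of freedom: the law of the sum of the squares
of `D` independent standard normal variables. -/
def chiSquared (D : ℕ) : Measure ℝ :=
  (Measure.pi fun _ : Fin D => gaussianReal 0 1).map fun z => ∑ i, z i ^ 2

instance (D : ℕ) : IsProbabilityMeasure (chiSquared D) :=
  Measure.isProbabilityMeasure_map (Measurable.aemeasurable (by fun_prop))

/-! ### Stochastic order notation -/

/-- `R k = o_P(1)`: convergence to `0` in probability. -/
def IsLittleOP {Ω : Type*} [MeasurableSpace Ω] (μ : Measure Ω) (R : ℕ → Ω → ℝ) : Prop :=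
  TendstoInMeasure μ R atTop fun _ => 0

/-- `A k = B (1 + o_P(1))` for random matrices `A k` and a fixed matrix `B`, where `1` is the
identity matrix and `o_P(1)` a random matrix whose entries converge to `0` in probability. -/
def IsMulOneAddOP {Ω : Type*} [MeasurableSpace Ω] {D : ℕ} (μ : Measure Ω)
    (A : ℕ → Ω → Matrix (Fin D) (Fin D) ℝ) (B : Matrix (Fin D) (Fin D) ℝ) : Prop :=
  ∃ E : ℕ → Ω → Matrix (Fin D) (Fin D) ℝ,
    (∀ i j, IsLittleOP μ fun k ω => E k ω i j) ∧ ∀ k ω, A k ω = B * (1 + E k ω)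

/-! ### Statistics of two samples `x₀` (of size `m₀`, class 0) and `x₁` (of size `m₁`, class 1) -/

/-- The quadratic form `vᵀ A v`. -/
def quadForm {D : ℕ} (A : Matrix (Fin D) (Fin D) ℝ) (v : Vec D) : ℝ :=
  v.ofLp ⬝ᵥ (A *ᵥ v.ofLp)

/-- The matrix `v vᵀ`. -/
def outer {D : ℕ} (v : Vec D) : Matrix (Fin D) (Fin D) ℝ :=
  Matrix.vecMulVec v.ofLp v.ofLp

/-- The sample mean vector. -/
def sampleMean {ι : Type*} [Fintype ι] {D : ℕ} (x : ι → Vec D) : Vec D :=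
  (Fintype.card ι : ℝ)⁻¹ • ∑ i, x i

/-- The scatter matrix `∑ᵢ (xᵢ - x̄)(xᵢ - x̄)ᵀ`. -/
def scatter {ι : Type*} [Fintype ι] {D : ℕ} (x : ι → Vec D) : Matrix (Fin D) (Fin D) ℝ :=
  ∑ i, outer (x i - sampleMean x)

/-- The pooled sample. -/
def pool {m₀ m₁ D : ℕ} (x₀ : Fin m₀ → Vec D) (x₁ : Fin m₁ → Vec D) : Fin m₀ ⊕ Fin m₁ → Vec D :=
  Sum.elim x₀ x₁

/-- The covariance matrix `S` of the combined sample (normalized by `n = m₀ + m₁`). -/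
def combinedCov {m₀ m₁ D : ℕ} (x₀ : Fin m₀ → Vec D) (x₁ : Fin m₁ → Vec D) :
    Matrix (Fin D) (Fin D) ℝ :=
  ((m₀ : ℝ) + m₁)⁻¹ • scatter (pool x₀ x₁)

/-- The pooled covariance matrix `S_p` (normalized by `m₀ + m₁ - 2`). -/
def pooledCov {m₀ m₁ D : ℕ} (x₀ : Fin m₀ → Vec D) (x₁ : Fin m₁ → Vec D) :
    Matrix (Fin D) (Fin D) ℝ :=
  ((m₀ : ℝ) + m₁ - 2)⁻¹ • (scatter x₀ + scatter x₁)

/-- The class proportion `π₀ = m₀ / n`. -/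
def prop₀ (m₀ m₁ : ℕ) : ℝ := (m₀ : ℝ) / ((m₀ : ℝ) + m₁)

/-- The class proportion `π₁ = m₁ / n`. -/
def prop₁ (m₀ m₁ : ℕ) : ℝ := (m₁ : ℝ) / ((m₀ : ℝ) + m₁)

/-- The regression estimator based on Fisher's linear discriminant analysis. -/
def mLDA {m₀ m₁ D : ℕ} (x₀ : Fin m₀ → Vec D) (x₁ : Fin m₁ → Vec D) (x : Vec D) : ℝ :=
  prop₁ m₀ m₁ * Real.exp (-(1 / 2) * quadForm (combinedCov x₀ x₁)⁻¹ (x - sampleMean x₁)) /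
    (prop₀ m₀ m₁ * Real.exp (-(1 / 2) * quadForm (combinedCov x₀ x₁)⁻¹ (x - sampleMean x₀)) +
      prop₁ m₀ m₁ * Real.exp (-(1 / 2) * quadForm (combinedCov x₀ x₁)⁻¹ (x - sampleMean x₁)))

/-- The regression test statistic `T̂_LDA = n⁻¹ ∑ᵢ (m̂_LDA(Xᵢ) - π₁)²`, the sum being over the
pooled sample. -/
def statLDA {m₀ m₁ D : ℕ} (x₀ : Fin m₀ → Vec D) (x₁ : Fin m₁ → Vec D) : ℝ :=
  ((m₀ : ℝ) + m₁)⁻¹ * ∑ i, (mLDA x₀ x₁ (pool x₀ x₁ i) - prop₁ m₀ m₁) ^ 2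

/-- Hotelling's two-sample `T²` statistic. -/
def hotelling {m₀ m₁ D : ℕ} (x₀ : Fin m₀ → Vec D) (x₁ : Fin m₁ → Vec D) : ℝ :=
  (m₀ : ℝ) * m₁ / ((m₀ : ℝ) + m₁) *
    quadForm (pooledCov x₀ x₁)⁻¹ (sampleMean x₀ - sampleMean x₁)

/-- The sample consisting of the first `m` members of a random sequence. -/
def firstN {Ω : Type*} {D : ℕ} (X : ℕ → Ω → Vec D) (m : ℕ) (ω : Ω) : Fin m → Vec D :=
  fun i => X i ω

end LDATwoSample

end

/-!
Under `μ₀ = μ₁` the discriminant direction `S⁻¹ (μ̂₁ - μ̂₀)` is of order `n^{-1/2}`, so the logistic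
function in `m̂_LDA` can be replaced by its tangent at `0`. With
`ℓᵢ = (Xᵢ - (μ̂₀ + μ̂₁) / 2)ᵀ S⁻¹ (μ̂₁ - μ̂₀)` one has `m̂_LDA(Xᵢ) - π₁ = g(ℓᵢ)` for the centred logistic
function `g`, and `|g(t)² - (π₀ π₁ t)²| ≤ 63 |t|³` for all `t` (`abs_centredLogistic_sq_sub_le`).

* The cubic error is `∑ |ℓᵢ|³ = O_P(n^{-3/2}) · O_P(n)`, the second factor by Markov's inequality for
  third moments (`sum_abs_score_pow_le`, `isLittleOP_linearization`).
* The quadratic term is explicit: as `n S` is the scatter about the pooled mean and `S⁻¹ S S⁻¹ = S⁻¹`,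
  `∑ ℓᵢ² = n Q + n (π₁ - 1/2)² Q²` with `Q = (μ̂₁ - μ̂₀)ᵀ S⁻¹ (μ̂₁ - μ̂₀)` (`sum_score_sq`), and
  `n Q² = O_P(1/n)`.
* `S⁻¹` and `S_p⁻¹` have the same limit in probability and may be exchanged in a quadratic form whose
  argument is bounded in probability (`isLittleOP_quadForm_sub`).

Hence `n T̂_LDA = n π₀² π₁² (μ̂₀ - μ̂₁)ᵀ S_p⁻¹ (μ̂₀ - μ̂₁) + o_P(1)`, which is `π₀ π₁ T²_Hotelling + o_P(1)`.

For the limit law, `√(n π₀ π₁) (μ̂₁ - μ̂₀) = √π₀ G₁ - √π₁ G₀` with independent standardized sums `G₀`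
and `G₁`. Their characteristic functions converge to that of `N(0, Σ)` by the one-dimensional central
limit theorem applied in each direction, and the squared weights add up to one, so Lévy's theorem gives
the limit `N(0, Σ)` for the combination. The image of `N(0, Σ)` under `z ↦ zᵀ Σ⁻¹ z` is `χ²_D`
(`map_quadForm_multivariateGaussian`); Slutsky's theorem passes from `Σ⁻¹` to `S_p⁻¹`.
-/

namespace LDATwoSample

/-! ### Calculus of `o_P` and `O_P` -/

section StochasticOrder

variable {Ω : Type*} [MeasurableSpace Ω] {μ : Measure Ω} {R Q : ℕ → Ω → ℝ}

/-- `R k = O_P(1)`: boundedness in probability. Only large `k` matter, so that a sequence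
may take junk values while the sample sizes are still zero. -/
def IsBigOP (μ : Measure Ω) (R : ℕ → Ω → ℝ) : Prop :=
  ∀ ε : ENNReal, 0 < ε → ∃ M : ℝ, 0 < M ∧ ∀ᶠ k in atTop, μ {ω | M ≤ |R k ω|} ≤ ε

theorem isLittleOP_iff : IsLittleOP μ R ↔
    ∀ δ : ℝ, 0 < δ → ∀ ε : ENNReal, 0 < ε → ∀ᶠ k in atTop, μ {ω | δ ≤ |R k ω|} ≤ ε := by
  unfold IsLittleOP
  rw [tendstoInMeasure_iff_norm]
  refine forall₂_congr fun δ _ => ?_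
  rw [ENNReal.tendsto_nhds_zero]
  simp [Real.norm_eq_abs]

theorem IsLittleOP.mono (h : IsLittleOP μ Q) (hle : ∀ᶠ k in atTop, ∀ ω, |R k ω| ≤ |Q k ω|) :
    IsLittleOP μ R := by
  rw [isLittleOP_iff] at h ⊢
  intro δ hδ ε hε
  filter_upwards [h δ hδ ε hε, hle] with k hk hle
  exact (measure_mono fun ω hω => le_trans hω (hle ω)).trans hk

theorem IsBigOP.mono (h : IsBigOP μ Q) (hle : ∀ᶠ k in atTop, ∀ ω, |R k ω| ≤ |Q k ω|) :
    IsBigOP μ R := by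
  intro ε hε
  obtain ⟨M, hM, h⟩ := h ε hε
  refine ⟨M, hM, ?_⟩
  filter_upwards [h, hle] with k hk hle
  exact (measure_mono fun ω hω => le_trans hω (hle ω)).trans hk

theorem IsLittleOP.congr (h : IsLittleOP μ Q) (heq : ∀ᶠ k in atTop, ∀ ω, R k ω = Q k ω) :
    IsLittleOP μ R :=
  h.mono <| heq.mono fun _ hk ω => (congrArg abs (hk ω)).le

theorem IsLittleOP.isBigOP (h : IsLittleOP μ R) : IsBigOP μ R := fun ε hε =>
  ⟨1, one_pos, isLittleOP_iff.1 h 1 one_pos ε hε⟩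

theorem measure_le_of_subset_union {s t u : Set Ω} {ε : ENNReal} (hs : s ⊆ t ∪ u)
    (ht : μ t ≤ ε / 2) (hu : μ u ≤ ε / 2) : μ s ≤ ε :=
  (measure_mono hs).trans <| (measure_union_le _ _).trans <|
    (add_le_add ht hu).trans (ENNReal.add_halves ε).le

theorem IsLittleOP.add (hR : IsLittleOP μ R) (hQ : IsLittleOP μ Q) :
    IsLittleOP μ fun k ω => R k ω + Q k ω := by
  rw [isLittleOP_iff] at *
  intro δ hδ ε hε
  filter_upwards [hR (δ / 2) (half_pos hδ) _ (ENNReal.half_pos hε.ne'),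
    hQ (δ / 2) (half_pos hδ) _ (ENNReal.half_pos hε.ne')] with k h₁ h₂
  refine measure_le_of_subset_union (fun ω hω => ?_) h₁ h₂
  by_contra hc
  simp only [Set.mem_union, Set.mem_ofPred_eq, not_or, not_le] at hc hω
  linarith [abs_add_le (R k ω) (Q k ω)]

theorem IsBigOP.add (hR : IsBigOP μ R) (hQ : IsBigOP μ Q) :
    IsBigOP μ fun k ω => R k ω + Q k ω := by
  intro ε hε
  obtain ⟨M, hM, h₁⟩ := hR _ (ENNReal.half_pos hε.ne')
  obtain ⟨N, hN, h₂⟩ := hQ _ (ENNReal.half_pos hε.ne')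
  refine ⟨M + N, by positivity, ?_⟩
  filter_upwards [h₁, h₂] with k h₁ h₂
  refine measure_le_of_subset_union (fun ω hω => ?_) h₁ h₂
  by_contra hc
  simp only [Set.mem_union, Set.mem_ofPred_eq, not_or, not_le] at hc hω
  linarith [abs_add_le (R k ω) (Q k ω)]

theorem IsBigOP.mul (hR : IsBigOP μ R) (hQ : IsBigOP μ Q) :
    IsBigOP μ fun k ω => R k ω * Q k ω := by
  intro ε hε
  obtain ⟨M, hM, h₁⟩ := hR _ (ENNReal.half_pos hε.ne')
  obtain ⟨N, hN, h₂⟩ := hQ _ (ENNReal.half_pos hε.ne')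
  refine ⟨M * N, by positivity, ?_⟩
  filter_upwards [h₁, h₂] with k h₁ h₂
  refine measure_le_of_subset_union (fun ω hω => ?_) h₁ h₂
  by_contra hc
  simp only [Set.mem_union, Set.mem_ofPred_eq, not_or, not_le, abs_mul] at hc hω
  exact absurd hω (not_le.2 (mul_lt_mul'' hc.1 hc.2 (abs_nonneg _) (abs_nonneg _)))

theorem IsBigOP.mul_isLittleOP (hR : IsBigOP μ R) (hQ : IsLittleOP μ Q) :
    IsLittleOP μ fun k ω => R k ω * Q k ω := by
  rw [isLittleOP_iff] at *
  intro δ hδ ε hε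
  obtain ⟨M, hM, h₁⟩ := hR _ (ENNReal.half_pos hε.ne')
  filter_upwards [h₁, hQ (δ / M) (by positivity) _ (ENNReal.half_pos hε.ne')] with k h₁ h₂
  refine measure_le_of_subset_union (fun ω hω => ?_) h₁ h₂
  by_contra hc
  simp only [Set.mem_union, Set.mem_ofPred_eq, not_or, not_le, abs_mul] at hc hω
  have := mul_lt_mul'' hc.1 hc.2 (abs_nonneg _) (abs_nonneg _)
  rw [mul_div_cancel₀ _ hM.ne'] at this
  linarith

theorem IsLittleOP.of_tendsto {a : ℕ → ℝ} (ha : Tendsto a atTop (𝓝 0)) :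
    IsLittleOP μ fun k _ => a k := by
  rw [isLittleOP_iff]
  intro δ hδ ε _
  filter_upwards [(tendsto_zero_iff_abs_tendsto_zero a).1 ha |>.eventually_lt_const hδ] with k hk
  simp [show ¬ δ ≤ |a k| from not_le.2 hk]

theorem IsBigOP.of_eventually_le {a : ℕ → ℝ} {C : ℝ} (ha : ∀ᶠ k in atTop, |a k| ≤ C) :
    IsBigOP μ fun k _ => a k := by
  intro ε _
  refine ⟨|C| + 1, by positivity, ?_⟩
  filter_upwards [ha] with k hk
  have : ¬ |C| + 1 ≤ |a k| := by linarith [le_abs_self C]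
  simp [this]

theorem IsBigOP.of_tendsto {a : ℕ → ℝ} {c : ℝ} (ha : Tendsto a atTop (𝓝 c)) :
    IsBigOP μ fun k _ => a k :=
  .of_eventually_le (ha.abs.eventually_le_const (lt_add_one |c|))

theorem isBigOP_const (c : ℝ) : IsBigOP μ fun _ _ => c :=
  .of_tendsto tendsto_const_nhds

theorem isLittleOP_zero : IsLittleOP μ fun _ _ => 0 :=
  .of_tendsto tendsto_const_nhds

theorem IsLittleOP.sum {ι : Type*} (s : Finset ι) {F : ι → ℕ → Ω → ℝ}
    (h : ∀ i ∈ s, IsLittleOP μ (F i)) : IsLittleOP μ fun k ω => ∑ i ∈ s, F i k ω := by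
  classical
  induction s using Finset.induction_on with
  | empty => simpa using isLittleOP_zero
  | insert a s ha ih =>
    simp only [Finset.sum_insert ha]
    exact (h a (by simp)).add (ih fun i hi => h i (by simp [hi]))

theorem IsBigOP.sum {ι : Type*} (s : Finset ι) {F : ι → ℕ → Ω → ℝ}
    (h : ∀ i ∈ s, IsBigOP μ (F i)) : IsBigOP μ fun k ω => ∑ i ∈ s, F i k ω := by
  classical
  induction s using Finset.induction_on with
  | empty => simpa using isBigOP_const 0
  | insert a s ha ih =>
    simp only [Finset.sum_insert ha]
    exact (h a (by simp)).add (ih fun i hi => h i (by simp [hi]))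

theorem IsBigOP.pow (h : IsBigOP μ R) (m : ℕ) : IsBigOP μ fun k ω => R k ω ^ m := by
  induction m with
  | zero => simpa using isBigOP_const 1
  | succ m ih => simpa only [pow_succ] using ih.mul h

theorem IsBigOP.abs (h : IsBigOP μ R) : IsBigOP μ fun k ω => |R k ω| :=
  h.mono <| .of_forall fun _ _ => (abs_abs _).le

theorem IsBigOP.sub (hR : IsBigOP μ R) (hQ : IsBigOP μ Q) :
    IsBigOP μ fun k ω => R k ω - Q k ω := by
  simpa [sub_eq_add_neg] using hR.add ((isBigOP_const (-1)).mul hQ)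

theorem IsLittleOP.sub (hR : IsLittleOP μ R) (hQ : IsLittleOP μ Q) :
    IsLittleOP μ fun k ω => R k ω - Q k ω := by
  simpa [sub_eq_add_neg] using hR.add ((isBigOP_const (-1)).mul_isLittleOP hQ)

/-- Markov's inequality: a sequence bounded in `L¹` is bounded in probability. -/
theorem IsBigOP.of_integral_le {C : ℝ} (hint : ∀ k, Integrable (R k) μ)
    (hR : ∀ k, 0 ≤ R k) (hC : ∀ k, ∫ ω, R k ω ∂μ ≤ C) : IsBigOP μ R := by
  intro ε hε
  have hC0 : 0 ≤ C := (integral_nonneg (hR 0)).trans (hC 0)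
  obtain ⟨M, hM, hMε⟩ : ∃ M : ℝ, 0 < M ∧ ENNReal.ofReal (C / M) ≤ ε := by
    have : Tendsto (fun M : ℝ => ENNReal.ofReal (C / M)) atTop (𝓝 0) := by
      simpa using ENNReal.tendsto_ofReal (tendsto_const_nhds.div_atTop tendsto_id (a := C))
    exact ((eventually_gt_atTop 0).and (this.eventually_le_const hε)).exists
  refine ⟨M, hM, .of_forall fun k => le_trans ?_ hMε⟩
  have habs : ∀ ω, |R k ω| = R k ω := fun ω => abs_of_nonneg (hR k ω)
  simp only [habs]
  refine (ENNReal.le_div_iff_mul_le (.inl (ENNReal.ofReal_pos.2 hM).ne')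
    (.inl ENNReal.ofReal_ne_top)).2 ?_ |>.trans_eq (ENNReal.ofReal_div_of_pos hM).symm
  rw [mul_comm]
  refine le_trans ?_ (ENNReal.ofReal_le_ofReal (hC k))
  rw [ofReal_integral_eq_lintegral_ofReal (hint k) (.of_forall (hR k))]
  refine le_trans ?_ (mul_meas_ge_le_lintegral₀ (hint k).aemeasurable.ennreal_ofReal
    (ENNReal.ofReal M))
  gcongr
  exact ENNReal.ofReal_le_ofReal

theorem IsBigOP.of_sq (h : IsBigOP μ fun k ω => R k ω ^ 2) : IsBigOP μ R := by
  intro ε hε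
  obtain ⟨M, hM, h⟩ := h ε hε
  refine ⟨√M, by positivity, h.mono fun k hk => (measure_mono fun ω hω => ?_).trans hk⟩
  have := pow_le_pow_left₀ (Real.sqrt_nonneg _) (show √M ≤ |R k ω| from hω) 2
  rw [Real.sq_sqrt hM.le] at this
  simpa using this

end StochasticOrder

/-! ### Expansion of the logistic function -/

section Logistic

/-- The centred logistic function with prior odds `b / a`: if `a + b = 1`, it vanishes at `0` and
has derivative `a * b` there. -/
noncomputable def centredLogistic (a b t : ℝ) : ℝ := b * Real.exp t / (a + b * Real.exp t) - b

variable {a b : ℝ}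

theorem centredLogistic_eq (ha : 0 < a) (hb : 0 < b) (hab : a + b = 1) (t : ℝ) :
    centredLogistic a b t = a * b * (Real.exp t - 1) / (a + b * Real.exp t) := by
  have h : a + b * Real.exp t ≠ 0 := by positivity
  obtain rfl : a = 1 - b := by linarith
  unfold centredLogistic
  field_simp
  ring

theorem abs_centredLogistic_le_one (ha : 0 < a) (hb : 0 < b) (hab : a + b = 1) (t : ℝ) :
    |centredLogistic a b t| ≤ 1 := by
  have he := Real.exp_pos t
  have h₀ : 0 ≤ b * Real.exp t / (a + b * Real.exp t) := by positivity
  have h₁ : b * Real.exp t / (a + b * Real.exp t) ≤ 1 :=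
    (div_le_one (by positivity)).2 (by linarith)
  unfold centredLogistic
  rw [abs_le]
  constructor <;> linarith

theorem third_le_logistic_denom (ha : 0 < a) (hb : 0 < b) (hab : a + b = 1) {t : ℝ}
    (ht : |t| ≤ 1) : 1 / 3 ≤ a + b * Real.exp t := by
  have h₁ : (1 / 3 : ℝ) ≤ Real.exp t := by
    have h₂ : Real.exp (-1) ≤ Real.exp t := Real.exp_le_exp.2 (neg_le_of_abs_le ht)
    have h₃ : 1 / 3 ≤ Real.exp (-1) := by
      rw [Real.exp_neg, one_div]
      exact inv_anti₀ (Real.exp_pos 1) Real.exp_one_lt_three.le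
    exact h₃.trans h₂
  nlinarith

theorem abs_centredLogistic_le (ha : 0 < a) (hb : 0 < b) (hab : a + b = 1) (t : ℝ) :
    |centredLogistic a b t| ≤ 6 * |t| := by
  rcases le_or_gt |t| 1 with ht | ht
  · have hd := third_le_logistic_denom ha hb hab ht
    have hd0 : 0 < a + b * Real.exp t := by linarith
    rw [centredLogistic_eq ha hb hab, abs_div, abs_mul, abs_of_pos hd0,
      abs_of_pos (mul_pos ha hb), div_le_iff₀ hd0]
    have h₁ := Real.abs_exp_sub_one_le ht
    have hab' : a * b ≤ 1 := by nlinarith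
    calc a * b * |Real.exp t - 1| ≤ 1 * (2 * |t|) := by gcongr
      _ = 6 * |t| * (1 / 3) := by ring
      _ ≤ _ := by gcongr
  · linarith [abs_centredLogistic_le_one ha hb hab t]

theorem abs_centredLogistic_sub_le (ha : 0 < a) (hb : 0 < b) (hab : a + b = 1) (t : ℝ) :
    |centredLogistic a b t - a * b * t| ≤ 9 * t ^ 2 := by
  have hab' : a * b ≤ 1 := by nlinarith
  rcases le_or_gt |t| 1 with ht | ht
  · have hd := third_le_logistic_denom ha hb hab ht
    have hd0 : 0 < a + b * Real.exp t := by linarith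
    have h₁ := Real.abs_exp_sub_one_le ht
    have h₂ := Real.abs_exp_sub_one_sub_id_le ht
    have key : centredLogistic a b t - a * b * t =
        a * b * ((Real.exp t - 1 - t) - t * (b * (Real.exp t - 1))) / (a + b * Real.exp t) := by
      rw [centredLogistic_eq ha hb hab, eq_div_iff hd0.ne', sub_mul, div_mul_cancel₀ _ hd0.ne']
      obtain rfl : a = 1 - b := by linarith
      ring
    rw [key, abs_div, abs_mul, abs_of_pos hd0, abs_of_pos (mul_pos ha hb), div_le_iff₀ hd0]
    have h₃ : |t * (b * (Real.exp t - 1))| ≤ 2 * t ^ 2 := by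
      rw [abs_mul, abs_mul, abs_of_pos hb, ← sq_abs t]
      calc |t| * (b * |Real.exp t - 1|) ≤ |t| * (1 * (2 * |t|)) := by
            gcongr
            linarith
        _ = 2 * |t| ^ 2 := by ring
    calc a * b * |(Real.exp t - 1 - t) - t * (b * (Real.exp t - 1))|
        ≤ 1 * (t ^ 2 + 2 * t ^ 2) := by
          gcongr
          exact (abs_sub _ _).trans (add_le_add h₂ h₃)
      _ = 9 * t ^ 2 * (1 / 3) := by ring
      _ ≤ _ := by gcongr
  · have h₁ := abs_centredLogistic_le_one ha hb hab t
    have h₂ : |a * b * t| ≤ |t| := by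
      rw [abs_mul, abs_of_pos (mul_pos ha hb)]
      exact mul_le_of_le_one_left (abs_nonneg t) hab'
    have h₃ : |t| ≤ t ^ 2 := by rw [← sq_abs]; nlinarith
    linarith [abs_sub (centredLogistic a b t) (a * b * t)]

theorem abs_centredLogistic_sq_sub_le (ha : 0 < a) (hb : 0 < b) (hab : a + b = 1) (t : ℝ) :
    |centredLogistic a b t ^ 2 - (a * b) ^ 2 * t ^ 2| ≤ 63 * |t| ^ 3 := by
  have hab' : a * b ≤ 1 := by nlinarith
  have h₁ := abs_centredLogistic_le ha hb hab t
  have h₂ := abs_centredLogistic_sub_le ha hb hab t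
  have h₃ : |centredLogistic a b t + a * b * t| ≤ 7 * |t| := by
    have : |a * b * t| ≤ |t| := by
      rw [abs_mul, abs_of_pos (mul_pos ha hb)]
      exact mul_le_of_le_one_left (abs_nonneg t) hab'
    linarith [abs_add_le (centredLogistic a b t) (a * b * t)]
  calc |centredLogistic a b t ^ 2 - (a * b) ^ 2 * t ^ 2|
      = |centredLogistic a b t - a * b * t| * |centredLogistic a b t + a * b * t| := by
        rw [← abs_mul]; ring_nf
    _ ≤ 9 * t ^ 2 * (7 * |t|) := by gcongr
    _ = 63 * |t| ^ 3 := by rw [← sq_abs t]; ring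

end Logistic

/-! ### Quadratic expansion of the LDA statistic -/

section Expansion

variable {D : ℕ}

theorem scatter_dotProduct_mulVec {ι : Type*} [Fintype ι] (x : ι → Vec D) (c : Fin D → ℝ) :
    c ⬝ᵥ (scatter x *ᵥ c) = ∑ i, ((x i - sampleMean x).ofLp ⬝ᵥ c) ^ 2 := by
  simp only [scatter, outer, Matrix.sum_mulVec, dotProduct_sum, Matrix.vecMulVec_mulVec,
    dotProduct_smul]
  refine Finset.sum_congr rfl fun i _ => ?_
  simp [dotProduct_comm c, sq]

theorem scatter_isSymm {ι : Type*} [Fintype ι] (x : ι → Vec D) : (scatter x).IsSymm := by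
  simp [Matrix.IsSymm, scatter, outer, Matrix.transpose_sum, Matrix.transpose_vecMulVec]

theorem sum_sub_sampleMean {ι : Type*} [Fintype ι] [Nonempty ι] (x : ι → Vec D) :
    ∑ i, (x i - sampleMean x) = 0 := by
  simp [Finset.sum_sub_distrib, sampleMean, ← Nat.cast_smul_eq_nsmul ℝ, smul_smul]

variable {m₀ m₁ : ℕ} (x₀ : Fin m₀ → Vec D) (x₁ : Fin m₁ → Vec D)

/-- The midpoint of the two sample means. -/
noncomputable def midMean : Vec D := (1 / 2 : ℝ) • (sampleMean x₀ + sampleMean x₁)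

/-- The direction `S⁻¹ (μ̂₁ - μ̂₀)` of the linear discriminant. -/
noncomputable def discriminant : Fin D → ℝ :=
  (combinedCov x₀ x₁)⁻¹ *ᵥ (sampleMean x₁ - sampleMean x₀).ofLp

theorem prop_add_prop (h₀ : 0 < m₀) : prop₀ m₀ m₁ + prop₁ m₀ m₁ = 1 := by
  have : (0 : ℝ) < m₀ := by exact_mod_cast h₀
  unfold prop₀ prop₁
  field_simp

theorem prop₀_pos (h₀ : 0 < m₀) : 0 < prop₀ m₀ m₁ := by
  have : (0 : ℝ) < m₀ := by exact_mod_cast h₀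
  unfold prop₀
  positivity

theorem prop₁_pos (h₁ : 0 < m₁) : 0 < prop₁ m₀ m₁ := by
  have : (0 : ℝ) < m₁ := by exact_mod_cast h₁
  unfold prop₁
  positivity

theorem inv_combinedCov_isSymm : ((combinedCov x₀ x₁)⁻¹).IsSymm := by
  have : (combinedCov x₀ x₁).IsSymm := (scatter_isSymm _).smul _
  rw [Matrix.IsSymm, Matrix.transpose_nonsing_inv, this.eq]

theorem quadForm_sub_quadForm {A : Matrix (Fin D) (Fin D) ℝ} (hA : A.IsSymm) (y v w : Vec D) :
    -(1 / 2) * quadForm A (y - w) - -(1 / 2) * quadForm A (y - v) =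
      (y - (1 / 2 : ℝ) • (v + w)).ofLp ⬝ᵥ (A *ᵥ (w - v).ofLp) := by
  have hsymm : ∀ p q : Fin D → ℝ, p ⬝ᵥ (A *ᵥ q) = q ⬝ᵥ (A *ᵥ p) := fun p q => by
    rw [Matrix.dotProduct_mulVec, ← Matrix.mulVec_transpose, hA.eq, dotProduct_comm]
  simp only [quadForm, WithLp.ofLp_sub, WithLp.ofLp_add, WithLp.ofLp_smul, Matrix.mulVec_sub,
    dotProduct_sub, sub_dotProduct, smul_dotProduct, add_dotProduct, smul_eq_mul]
  rw [hsymm w.ofLp y.ofLp, hsymm v.ofLp y.ofLp, hsymm w.ofLp v.ofLp]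
  ring

theorem mLDA_sub_prop (h₀ : 0 < m₀) (h₁ : 0 < m₁) (y : Vec D) :
    mLDA x₀ x₁ y - prop₁ m₀ m₁ = centredLogistic (prop₀ m₀ m₁) (prop₁ m₀ m₁)
      ((y - midMean x₀ x₁).ofLp ⬝ᵥ discriminant x₀ x₁) := by
  have hp₀ := prop₀_pos (m₁ := m₁) h₀
  have hp₁ := prop₁_pos (m₀ := m₀) h₁
  unfold midMean discriminant centredLogistic
  rw [← quadForm_sub_quadForm (inv_combinedCov_isSymm x₀ x₁), Real.exp_sub, mLDA]
  congr 1
  have := Real.exp_pos (-(1 / 2) * quadForm (combinedCov x₀ x₁)⁻¹ (y - sampleMean x₀))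
  have := Real.exp_pos (-(1 / 2) * quadForm (combinedCov x₀ x₁)⁻¹ (y - sampleMean x₁))
  field_simp

theorem sampleMean_pool (h₀ : 0 < m₀) (h₁ : 0 < m₁) :
    sampleMean (pool x₀ x₁) =
      prop₀ m₀ m₁ • sampleMean x₀ + prop₁ m₀ m₁ • sampleMean x₁ := by
  have : (0 : ℝ) < m₀ := by exact_mod_cast h₀
  have : (0 : ℝ) < m₁ := by exact_mod_cast h₁
  simp only [sampleMean, pool, Fintype.sum_sum_type, Sum.elim_inl, Sum.elim_inr, smul_add,
    smul_smul, prop₀, prop₁, Fintype.card_sum, Fintype.card_fin, Nat.cast_add]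
  congr 2 <;> field_simp

theorem sampleMean_pool_sub_midMean (h₀ : 0 < m₀) (h₁ : 0 < m₁) :
    sampleMean (pool x₀ x₁) - midMean x₀ x₁ =
      (prop₁ m₀ m₁ - 1 / 2) • (sampleMean x₁ - sampleMean x₀) := by
  rw [sampleMean_pool x₀ x₁ h₀ h₁, midMean,
    show prop₀ m₀ m₁ = 1 - prop₁ m₀ m₁ by linarith [prop_add_prop (m₁ := m₁) h₀]]
  module

/-- `A * S * A = A` for `A = S⁻¹` holds even for singular `S`, where `S⁻¹ = 0` by convention;
no separate treatment of singular sample covariances is needed. -/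
theorem nonsing_inv_mul_mul_nonsing_inv (S : Matrix (Fin D) (Fin D) ℝ) : S⁻¹ * S * S⁻¹ = S⁻¹ := by
  by_cases h : IsUnit S.det
  · rw [Matrix.nonsing_inv_mul _ h, one_mul]
  · simp [Matrix.nonsing_inv_apply_not_isUnit _ h]

/-- The parallel axis theorem for the linear discriminant scores: the scatter about the midpoint
of the two means is the scatter about the pooled mean plus a term that is quartic in
`μ̂₁ - μ̂₀`. -/
theorem sum_score_sq (h₀ : 0 < m₀) (h₁ : 0 < m₁) :
    ∑ i, ((pool x₀ x₁ i - midMean x₀ x₁).ofLp ⬝ᵥ discriminant x₀ x₁) ^ 2 =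
      ((m₀ : ℝ) + m₁) *
        quadForm (combinedCov x₀ x₁)⁻¹ (sampleMean x₁ - sampleMean x₀) +
      ((m₀ : ℝ) + m₁) * (prop₁ m₀ m₁ - 1 / 2) ^ 2 *
        quadForm (combinedCov x₀ x₁)⁻¹ (sampleMean x₁ - sampleMean x₀) ^ 2 := by
  have hn : (0 : ℝ) < (m₀ : ℝ) + m₁ := by
    have : (0 : ℝ) < m₀ := by exact_mod_cast h₀
    positivity
  have : Nonempty (Fin m₀ ⊕ Fin m₁) := ⟨Sum.inl ⟨0, h₀⟩⟩
  set c := discriminant x₀ x₁ with hc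
  set W := sampleMean x₁ - sampleMean x₀ with hW
  set A := (combinedCov x₀ x₁)⁻¹ with hA
  set e := sampleMean (pool x₀ x₁) - midMean x₀ x₁ with he
  have hscatter : scatter (pool x₀ x₁) = ((m₀ : ℝ) + m₁) • combinedCov x₀ x₁ := by
    rw [combinedCov, smul_smul, mul_inv_cancel₀ hn.ne', one_smul]
  have hmain : ∑ i, ((pool x₀ x₁ i - sampleMean (pool x₀ x₁)).ofLp ⬝ᵥ c) ^ 2 =
      ((m₀ : ℝ) + m₁) * quadForm A W := by
    rw [← scatter_dotProduct_mulVec, hscatter, Matrix.smul_mulVec, dotProduct_smul, smul_eq_mul]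
    congr 1
    have hcA : c = A *ᵥ W.ofLp := rfl
    have hASA : A * combinedCov x₀ x₁ * A = A := nonsing_inv_mul_mul_nonsing_inv _
    rw [quadForm, ← hASA, hcA, mul_assoc, ← Matrix.mulVec_mulVec, ← Matrix.mulVec_mulVec, Matrix.dotProduct_mulVec W.ofLp,
      ← Matrix.mulVec_transpose, (inv_combinedCov_isSymm x₀ x₁).eq]
  have hcross : ∑ i, (pool x₀ x₁ i - sampleMean (pool x₀ x₁)).ofLp ⬝ᵥ c = 0 := by
    have := congrArg (fun v : Vec D => v.ofLp ⬝ᵥ c) (sum_sub_sampleMean (pool x₀ x₁))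
    simpa only [WithLp.ofLp_sum, sum_dotProduct, WithLp.ofLp_zero, zero_dotProduct] using this
  have hec : e.ofLp ⬝ᵥ c = (prop₁ m₀ m₁ - 1 / 2) * quadForm A W := by
    rw [he, sampleMean_pool_sub_midMean x₀ x₁ h₀ h₁, WithLp.ofLp_smul, smul_dotProduct]
    rfl
  have hsplit : ∀ i, ((pool x₀ x₁ i - midMean x₀ x₁).ofLp ⬝ᵥ c) ^ 2 =
      ((pool x₀ x₁ i - sampleMean (pool x₀ x₁)).ofLp ⬝ᵥ c) ^ 2 +
        2 * (e.ofLp ⬝ᵥ c) * ((pool x₀ x₁ i - sampleMean (pool x₀ x₁)).ofLp ⬝ᵥ c) +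
          (e.ofLp ⬝ᵥ c) ^ 2 := fun i => by
    rw [← sub_add_sub_cancel (pool x₀ x₁ i) (sampleMean (pool x₀ x₁)) (midMean x₀ x₁),
      WithLp.ofLp_add, add_dotProduct]
    ring
  simp only [hsplit, Finset.sum_add_distrib, ← Finset.mul_sum, hmain, hcross, Finset.sum_const,
    Finset.card_univ, Fintype.card_sum, Fintype.card_fin, nsmul_eq_mul, hec]
  push_cast
  ring

theorem abs_statLDA_sub_le (h₀ : 0 < m₀) (h₁ : 0 < m₁) :
    |((m₀ : ℝ) + m₁) * statLDA x₀ x₁ - (prop₀ m₀ m₁ * prop₁ m₀ m₁) ^ 2 *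
        (((m₀ : ℝ) + m₁) *
          quadForm (combinedCov x₀ x₁)⁻¹ (sampleMean x₁ - sampleMean x₀) +
        ((m₀ : ℝ) + m₁) * (prop₁ m₀ m₁ - 1 / 2) ^ 2 *
          quadForm (combinedCov x₀ x₁)⁻¹ (sampleMean x₁ - sampleMean x₀) ^ 2)| ≤
      63 * ∑ i, |(pool x₀ x₁ i - midMean x₀ x₁).ofLp ⬝ᵥ discriminant x₀ x₁| ^ 3 := by
  have hn : (0 : ℝ) < (m₀ : ℝ) + m₁ := by
    have : (0 : ℝ) < m₀ := by exact_mod_cast h₀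
    positivity
  rw [← sum_score_sq x₀ x₁ h₀ h₁, statLDA, mul_inv_cancel_left₀ hn.ne', Finset.mul_sum,
    Finset.mul_sum, ← Finset.sum_sub_distrib]
  refine (Finset.abs_sum_le_sum_abs _ _).trans (Finset.sum_le_sum fun i _ => ?_)
  rw [mLDA_sub_prop x₀ x₁ h₀ h₁]
  exact abs_centredLogistic_sq_sub_le (prop₀_pos h₀) (prop₁_pos h₁) (prop_add_prop h₀) _

end Expansion

/-! ### Central limit theorem for one random sample in `ℝ^D` -/

section Population

variable {D : ℕ} {P : Measure (Vec D)}

theorem memLp_two_of_third [IsProbabilityMeasure P]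
    (hthird : Integrable (fun x => ‖x‖ ^ 3) P) :
    MemLp (fun x : Vec D => x) 2 P := by
  have h3 : MemLp (fun x : Vec D => x) 3 P := by
    refine (integrable_norm_rpow_iff aestronglyMeasurable_id (by norm_num) (by norm_num)).1 ?_
    refine hthird.congr (.of_forall fun x => ?_)
    change ‖x‖ ^ 3 = ‖x‖ ^ (ENNReal.toReal 3)
    rw [ENNReal.toReal_ofNat, ← Real.rpow_natCast, Nat.cast_ofNat]
  exact h3.mono_exponent (by norm_num)

theorem memLp_coord (h2 : MemLp (fun x : Vec D => x) 2 P) (i : Fin D) :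
    MemLp (fun x : Vec D => x i) 2 P :=
  h2.mono (Measurable.aestronglyMeasurable (by fun_prop))
    (.of_forall fun x => PiLp.norm_apply_le x i)

theorem variance_inner [IsProbabilityMeasure P]
    (h2 : MemLp (fun x : Vec D => x) 2 P) (t : Vec D) :
    Var[fun x : Vec D => inner ℝ x t; P] = t.ofLp ⬝ᵥ (covMatrix P *ᵥ t.ofLp) := by
  have h : (fun x : Vec D => inner ℝ x t) = fun x => ∑ i, t i * x i := by
    ext x
    simp [PiLp.inner_apply]
  rw [h, variance_fun_sum fun i => (memLp_coord h2 i).const_mul (t i)]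
  simp only [dotProduct, Matrix.mulVec, Finset.mul_sum]
  refine Finset.sum_congr rfl fun i _ => Finset.sum_congr rfl fun j _ => ?_
  rw [covariance_const_mul_left, covariance_const_mul_right]
  simp only [covMatrix, Matrix.of_apply]
  ring

theorem posSemidef_covMatrix [IsProbabilityMeasure P]
    (h2 : MemLp (fun x : Vec D => x) 2 P) :
    (covMatrix P).PosSemidef := by
  refine Matrix.PosSemidef.of_dotProduct_mulVec_nonneg ?_ fun x => ?_
  · ext i j
    simp [covMatrix, covariance_comm]
  · have := variance_inner h2 (WithLp.toLp 2 x)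
    simp only [star_trivial]
    exact (variance_nonneg _ _).trans_eq this

end Population

section Sample

variable {Ω : Type*} [MeasurableSpace Ω] {μ : Measure Ω} {D : ℕ}
  {P : Measure (Vec D)} {X : ℕ → Ω → Vec D} {m : Vec D}

/-- The standardized sum `n^{-1/2} ∑_{i < n} (Xᵢ - m)`. -/
noncomputable def stdSum (X : ℕ → Ω → Vec D) (m : Vec D) (n : ℕ) (ω : Ω) : Vec D :=
  (√(n : ℝ))⁻¹ • ∑ i ∈ Finset.range n, (X i ω - m)

theorem aemeasurable_stdSum (hX : ∀ i, AEMeasurable (X i) μ) (n : ℕ) :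
    AEMeasurable (stdSum X m n) μ := by
  unfold stdSum
  have h : AEMeasurable (fun ω => ∑ i ∈ Finset.range n, (X i ω - m)) μ :=
    Finset.aemeasurable_fun_sum _ fun i _ => (hX i).sub_const m
  exact h.const_smul (√(n : ℝ))⁻¹

/-- The central limit theorem in `ℝ^D`, reduced to the one-dimensional one by projecting onto the
direction `t` (Cramér–Wold). -/
theorem tendsto_charFun_stdSum [IsProbabilityMeasure μ] [IsProbabilityMeasure P]
    (hlaw : ∀ i, HasLaw (X i) P μ) (hindep : iIndepFun X μ)
    (h2 : MemLp (fun x : Vec D => x) 2 P) (hm : ∫ x, x ∂P = m) (t : Vec D) :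
    Tendsto (fun n => charFun (μ.map (stdSum X m n)) t) atTop
      (𝓝 (Complex.exp (-((t.ofLp ⬝ᵥ (covMatrix P *ᵥ t.ofLp) : ℝ) : ℂ) / 2))) := by
  have hinner : Measurable fun x : Vec D => inner ℝ x t := by fun_prop
  set Y : ℕ → Ω → ℝ := fun i ω => inner ℝ (X i ω) t with hY
  have hident : ∀ i, IdentDistrib (Y i) (Y 0) μ μ := fun i =>
    IdentDistrib.comp (u := fun x : Vec D => inner ℝ x t) (f := X i) (g := X 0)
      ⟨(hlaw i).aemeasurable, (hlaw 0).aemeasurable,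
        (hlaw i).map_eq.trans (hlaw 0).map_eq.symm⟩ hinner
  have hmem : MemLp (fun x : Vec D => inner ℝ x t) 2 P := h2.inner_const t
  have hmem' : MemLp (Y 0) 2 μ := by
    rw [← (hlaw 0).map_eq] at hmem
    exact hmem.comp_of_map (hlaw 0).aemeasurable
  have hmean : ∫ ω, Y 0 ω ∂μ = inner ℝ m t := by
    have h₁ : ∫ ω, Y 0 ω ∂μ = ∫ x, inner ℝ x t ∂P := (hlaw 0).integral_comp
      (f := fun x : Vec D => inner ℝ x t) hinner.aestronglyMeasurable
    have h₂ : ∫ x, inner ℝ x t ∂P = inner ℝ (∫ x, x ∂P) t := by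
      simp only [real_inner_comm t]
      exact integral_inner (h2.integrable (by norm_num)) t
    rw [h₁, h₂, hm]
  have hvar : Var[Y 0; μ] = t.ofLp ⬝ᵥ (covMatrix P *ᵥ t.ofLp) := by
    rw [← variance_inner h2 t, ← (hlaw 0).map_eq,
      variance_map hinner.aemeasurable (hlaw 0).aemeasurable]
    rfl
  have hind : iIndepFun Y μ := hindep.comp (fun _ x => inner ℝ x t) fun _ => hinner
  have hclt := tendstoInDistribution_inv_sqrt_mul_sum_sub
    (Y := id) (P' := gaussianReal 0 Var[Y 0; μ].toNNReal) HasLaw.id hmem' hind hident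
  -- the characteristic function of a vector at `t` is that of its projection onto `t` at `1`
  have hchar := ProbabilityMeasure.tendsto_iff_tendsto_charFun.1 hclt.tendsto 1
  simp only [ProbabilityMeasure.coe_mk, Measure.map_id, charFun_gaussianReal] at hchar
  convert hchar using 2 with n
  · rw [charFun_apply, charFun_apply,
      integral_map (aemeasurable_stdSum (fun i => (hlaw i).aemeasurable) n)
        (Measurable.aestronglyMeasurable (by fun_prop)),
      integral_map (hclt.forall_aemeasurable n) (Measurable.aestronglyMeasurable (by fun_prop))]
    congr 1
    ext ω
    congr 2
    rw [hmean]
    simp [stdSum, hY, inner_smul_left, sum_inner, inner_sub_left, Finset.sum_sub_distrib,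
      ← Nat.cast_smul_eq_nsmul ℝ]
  · rw [← hvar, Real.coe_toNNReal _ (variance_nonneg _ _)]
    simp [neg_div]

/-- Standardized sums are bounded in probability along every sequence of sample sizes, because
their coordinates have variance at most that of the population. -/
theorem isBigOP_stdSum [IsProbabilityMeasure μ] [IsProbabilityMeasure P]
    (hlaw : ∀ i, HasLaw (X i) P μ) (hindep : iIndepFun X μ)
    (h2 : MemLp (fun x : Vec D => x) 2 P) (hm : ∫ x, x ∂P = m) (n : ℕ → ℕ) (j : Fin D) :
    IsBigOP μ fun k ω => stdSum X m (n k) ω j := by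
  set Y : ℕ → Ω → ℝ := fun i ω => X i ω j - m j with hY
  have hmeas : Measurable fun x : Vec D => x j - m j := by fun_prop
  have hP : MemLp (fun x : Vec D => x j - m j) 2 P := (memLp_coord h2 j).sub (memLp_const _)
  have hmem : ∀ i, MemLp (Y i) 2 μ := fun i => by
    have := hP
    rw [← (hlaw i).map_eq] at this
    exact this.comp_of_map (hlaw i).aemeasurable
  have hmean : ∀ i, ∫ ω, Y i ω ∂μ = 0 := fun i => by
    have h₁ := (hlaw i).integral_comp (f := fun x : Vec D => x j - m j) hmeas.aestronglyMeasurable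
    have h₂ : ∫ x : Vec D, x j ∂P = m j := by
      rw [← hm]
      exact (EuclideanSpace.proj (𝕜 := ℝ) j).integral_comp_comm (h2.integrable (by norm_num))
    refine h₁.trans ?_
    rw [integral_sub ((memLp_coord h2 j).integrable (by norm_num)) (integrable_const _), h₂]
    simp
  set v := Var[fun x : Vec D => x j - m j; P] with hv
  have hvar : ∀ i, Var[Y i; μ] = v := fun i => by
    rw [hv, ← (hlaw i).map_eq, variance_map hmeas.aemeasurable (hlaw i).aemeasurable]
    rfl
  have hind : iIndepFun Y μ := hindep.comp (fun _ x => x j - m j) fun _ => hmeas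
  have hsq : ∀ N, ∫ ω, (∑ i ∈ Finset.range N, Y i ω) ^ 2 ∂μ = N * v := fun N => by
    have h₁ := IndepFun.variance_sum (s := Finset.range N) (fun i _ => hmem i)
      fun i _ i' _ h => hind.indepFun h
    rw [variance_of_integral_eq_zero
      (Finset.aemeasurable_sum _ fun i _ => (hmem i).aemeasurable)] at h₁
    · simpa [hvar] using h₁
    · simp only [Finset.sum_apply]
      rw [integral_finsetSum _ fun i _ => (hmem i).integrable (by norm_num)]
      simp [hmean]
  have hrepr : ∀ N ω, stdSum X m N ω j ^ 2 = (N : ℝ)⁻¹ * (∑ i ∈ Finset.range N, Y i ω) ^ 2 :=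
    fun N ω => by simp [stdSum, hY, mul_pow]
  refine IsBigOP.of_sq ?_
  simp only [hrepr]
  refine IsBigOP.of_integral_le (C := v) (fun k => ?_) (fun k ω => by positivity) fun k => ?_
  · exact (memLp_finsetSum _ fun i _ => hmem i).integrable_sq.const_mul _
  · rw [integral_const_mul, hsq, ← mul_assoc]
    exact mul_le_of_le_one_left (variance_nonneg _ _) (inv_mul_le_one (a := ((n k : ℕ) : ℝ)))

theorem isBigOP_average (hlaw : ∀ i, HasLaw (X i) P μ) {f : Vec D → ℝ} (hf : Integrable f P)
    (hf0 : ∀ x, 0 ≤ f x) (n : ℕ → ℕ) :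
    IsBigOP μ fun k ω => ((n k : ℕ) : ℝ)⁻¹ * ∑ i ∈ Finset.range (n k), f (X i ω) := by
  have hint : ∀ i, Integrable (fun ω => f (X i ω)) μ := fun i => by
    have := hf
    rw [← (hlaw i).map_eq] at this
    exact this.comp_aemeasurable (hlaw i).aemeasurable
  refine IsBigOP.of_integral_le (C := ∫ x, f x ∂P) (fun k => ?_) (fun k ω => ?_) fun k => ?_
  · exact (integrable_finsetSum _ fun i _ => hint i).const_mul _
  · exact mul_nonneg (by positivity) (Finset.sum_nonneg fun i _ => hf0 _)
  · have h : ∀ i, ∫ ω, f (X i ω) ∂μ = ∫ x, f x ∂P := fun i =>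
      (hlaw i).integral_comp hf.aestronglyMeasurable
    rw [integral_const_mul, integral_finsetSum _ fun i _ => hint i]
    simp only [h, Finset.sum_const, Finset.card_range, nsmul_eq_mul, ← mul_assoc]
    exact mul_le_of_le_one_left (integral_nonneg hf0) (inv_mul_le_one (a := ((n k : ℕ) : ℝ)))

end Sample

/-! ### The chi-squared limit of the standardized mean difference -/

section Gaussian

variable {D : ℕ}

open scoped MatrixOrder Matrix.Norms.L2Operator in
/-- If `S` is a nonsingular covariance matrix, then `zᵀ S⁻¹ z` is chi-squared distributed under
`N(0, S)`: in the representation `z = √S w` with `w` standard normal it equals `wᵀ w`. -/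
theorem map_quadForm_multivariateGaussian {S : Matrix (Fin D) (Fin D) ℝ} (hS : S.PosSemidef)
    (hdet : IsUnit S.det) :
    (multivariateGaussian 0 S).map (quadForm S⁻¹) = chiSquared D := by
  set R := CFC.sqrt S with hR
  have hRR : R * R = S := CFC.sqrt_mul_sqrt_self S hS.nonneg
  have hRdet : IsUnit R.det := by
    rw [← hRR, Matrix.det_mul] at hdet
    exact isUnit_of_mul_isUnit_left hdet
  have hRsymm : Rᵀ = R := by
    have : R.IsHermitian := (CFC.sqrt_nonneg S).isSelfAdjoint
    rwa [Matrix.IsHermitian, Matrix.conjTranspose_eq_transpose_of_trivial] at this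
  have hone : R * S⁻¹ * R = 1 := by
    rw [← hRR, Matrix.mul_inv_rev, ← mul_assoc, Matrix.mul_nonsing_inv _ hRdet, one_mul,
      Matrix.nonsing_inv_mul _ hRdet]
  have hquad : Measurable (quadForm (D := D) S⁻¹) := by
    unfold quadForm dotProduct Matrix.mulVec dotProduct
    fun_prop
  have hlin : Measurable fun x : Vec D => (0 : Vec D) + Matrix.toEuclideanCLM (𝕜 := ℝ) R x := by
    fun_prop
  rw [multivariateGaussian, ← map_pi_eq_stdGaussian, ← hR, Measure.map_map hlin (by fun_prop),
    Measure.map_map hquad (hlin.comp (by fun_prop)), chiSquared]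
  congr 1
  ext z
  have : (R *ᵥ z) ⬝ᵥ (S⁻¹ *ᵥ (R *ᵥ z)) = z ⬝ᵥ z := by
    have hRz : R *ᵥ z = z ᵥ* R := by rw [← Matrix.mulVec_transpose, hRsymm]
    rw [Matrix.mulVec_mulVec]
    nth_rewrite 1 [hRz]
    rw [← Matrix.dotProduct_mulVec, Matrix.mulVec_mulVec, ← mul_assoc, hone, Matrix.one_mulVec]
  simpa [quadForm, dotProduct, sq] using this

/-- Convergence in distribution only depends on the law of the limit. -/
theorem _root_.MeasureTheory.TendstoInDistribution.of_map_eq {Ω Ω' Ω'' E : Type*}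
    [MeasurableSpace Ω] [MeasurableSpace Ω'] [MeasurableSpace Ω''] [MeasurableSpace E]
    [TopologicalSpace E] [OpensMeasurableSpace E] {μ : Measure Ω} {μ' : Measure Ω'}
    {μ'' : Measure Ω''} [IsProbabilityMeasure μ] [IsProbabilityMeasure μ']
    [IsProbabilityMeasure μ''] {X : ℕ → Ω → E} {Z : Ω' → E} {W : Ω'' → E}
    (h : TendstoInDistribution X atTop Z (fun _ => μ) μ') (hW : AEMeasurable W μ'')
    (heq : μ'.map Z = μ''.map W) : TendstoInDistribution X atTop W (fun _ => μ) μ'' where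
  forall_aemeasurable := h.forall_aemeasurable
  aemeasurable_limit := hW
  tendsto := by
    have : (⟨μ''.map W, Measure.isProbabilityMeasure_map hW⟩ : ProbabilityMeasure E) =
        ⟨μ'.map Z, Measure.isProbabilityMeasure_map h.aemeasurable_limit⟩ :=
      Subtype.ext heq.symm
    rw [this]
    exact h.tendsto

end Gaussian

section TwoSample

variable {Ω : Type*} [MeasurableSpace Ω] {μ : Measure Ω} {D : ℕ}
  {P₀ P₁ : Measure (Vec D)} [IsProbabilityMeasure P₀] [IsProbabilityMeasure P₁]
  {X₀ X₁ : ℕ → Ω → Vec D} {m : Vec D} {S : Matrix (Fin D) (Fin D) ℝ}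

theorem indepFun_stdSum (hX₀ : ∀ i, AEMeasurable (X₀ i) μ) (hX₁ : ∀ i, AEMeasurable (X₁ i) μ)
    (hindep : iIndepFun (Sum.elim X₀ X₁) μ) (k l : ℕ) :
    IndepFun (stdSum X₀ m k) (stdSum X₁ m l) μ := by
  classical
  set s : Finset (ℕ ⊕ ℕ) := (Finset.range k).map ⟨Sum.inl, Sum.inl_injective⟩ with hs
  set t : Finset (ℕ ⊕ ℕ) := (Finset.range l).map ⟨Sum.inr, Sum.inr_injective⟩ with ht
  have hst : Disjoint s t := by
    rw [Finset.disjoint_left]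
    simp [hs, ht]
  have hmeas : ∀ i, AEMeasurable (Sum.elim X₀ X₁ i) μ := by
    rintro (i | i)
    exacts [hX₀ i, hX₁ i]
  have h := hindep.indepFun_finset₀ s t hst hmeas
  have hφ : ∀ (u : Finset (ℕ ⊕ ℕ)) (n : ℕ),
      Measurable fun x : u → Vec D => (√(n : ℝ))⁻¹ • ∑ i : u, (x i - m) := fun u n => by
    fun_prop
  convert h.comp (hφ s k) (hφ t l) using 1
  · ext1 ω
    simp only [Function.comp_apply, stdSum]
    rw [Finset.sum_coe_sort s fun i => Sum.elim X₀ X₁ i ω - m, hs, Finset.sum_map]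
    rfl
  · ext1 ω
    simp only [Function.comp_apply, stdSum]
    rw [Finset.sum_coe_sort t fun i => Sum.elim X₀ X₁ i ω - m, ht, Finset.sum_map]
    rfl

/-- The two-sample central limit theorem. A combination of the two standardized sums whose squared
weights add up to one has the same Gaussian limit as each of them. -/
theorem tendstoInDistribution_stdSum_combination [IsProbabilityMeasure μ]
    (hlaw₀ : ∀ i, HasLaw (X₀ i) P₀ μ)
    (hlaw₁ : ∀ i, HasLaw (X₁ i) P₁ μ) (hindep : iIndepFun (Sum.elim X₀ X₁) μ)
    (h2₀ : MemLp (fun x : Vec D => x) 2 P₀) (h2₁ : MemLp (fun x : Vec D => x) 2 P₁)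
    (hm₀ : ∫ x, x ∂P₀ = m) (hm₁ : ∫ x, x ∂P₁ = m)
    (hcov₀ : covMatrix P₀ = S) (hcov₁ : covMatrix P₁ = S) {n₀ n₁ : ℕ → ℕ}
    (hn₀ : Tendsto n₀ atTop atTop) (hn₁ : Tendsto n₁ atTop atTop) {a b : ℝ}
    (hab : a ^ 2 + b ^ 2 = 1) :
    TendstoInDistribution
      (fun k ω => a • stdSum X₀ m (n₀ k) ω + b • stdSum X₁ m (n₁ k) ω) atTop
      id (fun _ => μ) (multivariateGaussian 0 S) := by
  have hX₀ : ∀ i, AEMeasurable (X₀ i) μ := fun i => (hlaw₀ i).aemeasurable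
  have hX₁ : ∀ i, AEMeasurable (X₁ i) μ := fun i => (hlaw₁ i).aemeasurable
  have hG₀ : ∀ k, AEMeasurable (fun ω => a • stdSum X₀ m (n₀ k) ω) μ := fun k =>
    (aemeasurable_stdSum hX₀ (n₀ k)).const_smul a
  have hG₁ : ∀ k, AEMeasurable (fun ω => b • stdSum X₁ m (n₁ k) ω) μ := fun k =>
    (aemeasurable_stdSum hX₁ (n₁ k)).const_smul b
  have hmeas : ∀ k, AEMeasurable
      (fun ω => a • stdSum X₀ m (n₀ k) ω + b • stdSum X₁ m (n₁ k) ω) μ := fun k =>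
    (hG₀ k).add (hG₁ k)
  refine ⟨hmeas, aemeasurable_id, ?_⟩
  refine ProbabilityMeasure.tendsto_iff_tendsto_charFun.2 fun t => ?_
  simp only [ProbabilityMeasure.coe_mk, Measure.map_id]
  have hchar : ∀ k, charFun (μ.map fun ω => a • stdSum X₀ m (n₀ k) ω + b • stdSum X₁ m (n₁ k) ω) t =
      charFun (μ.map (stdSum X₀ m (n₀ k))) (a • t) * charFun (μ.map (stdSum X₁ m (n₁ k))) (b • t) :=
    fun k => by
    have hind : IndepFun (fun ω => a • stdSum X₀ m (n₀ k) ω) (fun ω => b • stdSum X₁ m (n₁ k) ω) μ :=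
      (indepFun_stdSum hX₀ hX₁ hindep (n₀ k) (n₁ k)).comp (φ := fun x => a • x)
        (ψ := fun x => b • x) (by fun_prop) (by fun_prop)
    rw [hind.charFun_map_fun_add_eq_mul (hG₀ k) (hG₁ k), Pi.mul_apply,
      charFun_map_smul_comp (aemeasurable_stdSum hX₀ _),
      charFun_map_smul_comp (aemeasurable_stdSum hX₁ _)]
  have hindep₀ : iIndepFun X₀ μ := hindep.precomp (g := Sum.inl) Sum.inl_injective
  have hindep₁ : iIndepFun X₁ μ := hindep.precomp (g := Sum.inr) Sum.inr_injective
  simp only [hchar]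
  have hlim := ((tendsto_charFun_stdSum hlaw₀ hindep₀ h2₀ hm₀ (a • t)).comp hn₀).mul
    ((tendsto_charFun_stdSum hlaw₁ hindep₁ h2₁ hm₁ (b • t)).comp hn₁)
  refine hlim.trans_eq ?_
  rw [charFun_multivariateGaussian (hcov₀ ▸ posSemidef_covMatrix h2₀), ← Complex.exp_add, hcov₀,
    hcov₁]
  congr 2
  simp only [WithLp.ofLp_smul, Matrix.mulVec_smul, dotProduct_smul, smul_dotProduct, smul_eq_mul,
    inner_zero_right, Complex.ofReal_mul, Complex.ofReal_zero, zero_mul, zero_sub]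
  have hab' : (a : ℂ) ^ 2 + (b : ℂ) ^ 2 = 1 := by exact_mod_cast hab
  linear_combination (-((t.ofLp ⬝ᵥ S *ᵥ t.ofLp : ℝ) : ℂ) / 2) * hab'

theorem tendstoInDistribution_quadForm_stdSum [IsProbabilityMeasure μ]
    (hlaw₀ : ∀ i, HasLaw (X₀ i) P₀ μ)
    (hlaw₁ : ∀ i, HasLaw (X₁ i) P₁ μ) (hindep : iIndepFun (Sum.elim X₀ X₁) μ)
    (h2₀ : MemLp (fun x : Vec D => x) 2 P₀) (h2₁ : MemLp (fun x : Vec D => x) 2 P₁)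
    (hm₀ : ∫ x, x ∂P₀ = m) (hm₁ : ∫ x, x ∂P₁ = m)
    (hcov₀ : covMatrix P₀ = S) (hcov₁ : covMatrix P₁ = S) (hS : IsUnit S.det) {n₀ n₁ : ℕ → ℕ}
    (hn₀ : Tendsto n₀ atTop atTop) (hn₁ : Tendsto n₁ atTop atTop) {a b : ℝ}
    (hab : a ^ 2 + b ^ 2 = 1) :
    TendstoInDistribution
      (fun k ω => quadForm S⁻¹ (a • stdSum X₀ m (n₀ k) ω + b • stdSum X₁ m (n₁ k) ω)) atTop
      id (fun _ => μ) (chiSquared D) := by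
  have hcont : Continuous (quadForm (D := D) S⁻¹) := by
    unfold quadForm dotProduct Matrix.mulVec dotProduct
    fun_prop
  refine ((tendstoInDistribution_stdSum_combination hlaw₀ hlaw₁ hindep h2₀ h2₁ hm₀ hm₁ hcov₀ hcov₁
    hn₀ hn₁ hab).continuous_comp hcont).of_map_eq aemeasurable_id ?_
  rw [Measure.map_id, Function.comp_id]
  exact map_quadForm_multivariateGaussian (hcov₀ ▸ posSemidef_covMatrix h2₀) hS

end TwoSample

/-! ### Measurability of the statistics -/

section Measurability

variable {α : Type*} [MeasurableSpace α] {D m₀ m₁ : ℕ}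

theorem measurable_det {A : α → Matrix (Fin D) (Fin D) ℝ}
    (hA : ∀ i j, Measurable fun a => A a i j) : Measurable fun a => (A a).det := by
  simp only [Matrix.det_apply]
  fun_prop

theorem measurable_nonsing_inv_apply {A : α → Matrix (Fin D) (Fin D) ℝ}
    (hA : ∀ i j, Measurable fun a => A a i j) (i j : Fin D) :
    Measurable fun a => (A a)⁻¹ i j := by
  simp only [Matrix.inv_def, Matrix.smul_apply, Ring.inverse_eq_inv', Matrix.adjugate_apply,
    smul_eq_mul]
  refine (measurable_det hA).inv.mul (measurable_det fun k l => ?_)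
  by_cases h : k = j
  · subst h
    simp
  · simpa [Matrix.updateRow_ne h] using hA k l

theorem measurable_quadForm {A : α → Matrix (Fin D) (Fin D) ℝ} {v : α → Vec D}
    (hA : ∀ i j, Measurable fun a => A a i j) (hv : Measurable v) :
    Measurable fun a => quadForm (A a) (v a) := by
  unfold quadForm dotProduct Matrix.mulVec dotProduct
  fun_prop

theorem measurable_sampleMean {ι : Type*} [Fintype ι] {x : α → ι → Vec D}
    (hx : ∀ i, Measurable fun a => x a i) : Measurable fun a => sampleMean (x a) := by
  unfold sampleMean
  fun_prop

theorem measurable_scatter_apply {ι : Type*} [Fintype ι] {x : α → ι → Vec D}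
    (hx : ∀ i, Measurable fun a => x a i) (i j : Fin D) :
    Measurable fun a => scatter (x a) i j := by
  have := measurable_sampleMean hx
  simp only [scatter, outer, Matrix.sum_apply, Matrix.vecMulVec_apply]
  fun_prop

theorem measurable_hotelling :
    Measurable fun z : (Fin m₀ → Vec D) × (Fin m₁ → Vec D) => hotelling z.1 z.2 := by
  have h₀ : ∀ i, Measurable fun z : (Fin m₀ → Vec D) × (Fin m₁ → Vec D) => z.1 i := by fun_prop
  have h₁ : ∀ i, Measurable fun z : (Fin m₀ → Vec D) × (Fin m₁ → Vec D) => z.2 i := by fun_prop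
  refine (measurable_quadForm (measurable_nonsing_inv_apply fun i j => ?_)
    ((measurable_sampleMean h₀).sub (measurable_sampleMean h₁))).const_mul _
  simp only [pooledCov, Matrix.smul_apply, Matrix.add_apply, smul_eq_mul]
  exact ((measurable_scatter_apply h₀ i j).add (measurable_scatter_apply h₁ i j)).const_mul _

theorem measurable_statLDA :
    Measurable fun z : (Fin m₀ → Vec D) × (Fin m₁ → Vec D) => statLDA z.1 z.2 := by
  have h₀ : ∀ i, Measurable fun z : (Fin m₀ → Vec D) × (Fin m₁ → Vec D) => z.1 i := by fun_prop
  have h₁ : ∀ i, Measurable fun z : (Fin m₀ → Vec D) × (Fin m₁ → Vec D) => z.2 i := by fun_prop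
  have hpool : ∀ i, Measurable
      fun z : (Fin m₀ → Vec D) × (Fin m₁ → Vec D) => pool z.1 z.2 i := by
    rintro (i | i)
    exacts [h₀ i, h₁ i]
  have hinv : ∀ i j, Measurable
      fun z : (Fin m₀ → Vec D) × (Fin m₁ → Vec D) => (combinedCov z.1 z.2)⁻¹ i j := by
    refine fun i j => measurable_nonsing_inv_apply (fun i j => ?_) i j
    simp only [combinedCov, Matrix.smul_apply, smul_eq_mul]
    exact (measurable_scatter_apply hpool i j).const_mul _
  have hq₀ := fun i => measurable_quadForm hinv ((hpool i).sub (measurable_sampleMean h₀))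
  have hq₁ := fun i => measurable_quadForm hinv ((hpool i).sub (measurable_sampleMean h₁))
  have hm : ∀ i, Measurable
      fun z : (Fin m₀ → Vec D) × (Fin m₁ → Vec D) => mLDA z.1 z.2 (pool z.1 z.2 i) := fun i =>
    (((hq₁ i).const_mul _).exp.const_mul _).div
      ((((hq₀ i).const_mul _).exp.const_mul _).add (((hq₁ i).const_mul _).exp.const_mul _))
  exact (Finset.measurable_fun_sum _ fun i _ => ((hm i).sub_const _).pow_const 2).const_mul _

theorem aemeasurable_comp_firstN {μ : Measure α} {X₀ X₁ : ℕ → α → Vec D}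
    {F : (Fin m₀ → Vec D) → (Fin m₁ → Vec D) → ℝ} (hF : Measurable fun z : _ × _ => F z.1 z.2)
    (hX₀ : ∀ i, AEMeasurable (X₀ i) μ) (hX₁ : ∀ i, AEMeasurable (X₁ i) μ) :
    AEMeasurable (fun ω => F (firstN X₀ m₀ ω) (firstN X₁ m₁ ω)) μ := by
  have h₀ : AEMeasurable (firstN X₀ m₀) μ := aemeasurable_pi_lambda _ fun i => hX₀ i
  have h₁ : AEMeasurable (firstN X₁ m₁) μ := aemeasurable_pi_lambda _ fun i => hX₁ i
  exact hF.comp_aemeasurable (h₀.prodMk h₁)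

end Measurability

/-! ### Asymptotic negligibility of the remainder terms -/

section Remainder

theorem sampleMean_firstN_sub {Ω : Type*} {D : ℕ} {X : ℕ → Ω → Vec D} (m : Vec D) {N : ℕ} (hN : 0 < N) (ω : Ω) :
    sampleMean (firstN X N ω) - m = (√(N : ℝ))⁻¹ • stdSum X m N ω := by
  have h : (N : ℝ) ≠ 0 := by exact_mod_cast hN.ne'
  have h' : (√(N : ℝ))⁻¹ * (√(N : ℝ))⁻¹ = (N : ℝ)⁻¹ := by
    rw [← mul_inv, Real.mul_self_sqrt (Nat.cast_nonneg N)]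
  rw [stdSum, smul_smul, h', Finset.sum_sub_distrib, Finset.sum_const, Finset.card_range,
    ← Nat.cast_smul_eq_nsmul ℝ, smul_sub, inv_smul_smul₀ h, sampleMean, Fintype.card_fin,
    Finset.sum_range]
  rfl

variable {Ω : Type*} [MeasurableSpace Ω] {μ : Measure Ω} {D : ℕ}

theorem quadForm_smul (A : Matrix (Fin D) (Fin D) ℝ) (c : ℝ) (v : Vec D) :
    quadForm A (c • v) = c ^ 2 * quadForm A v := by
  simp only [quadForm, WithLp.ofLp_smul, Matrix.mulVec_smul, dotProduct_smul, smul_dotProduct,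
    smul_eq_mul]
  ring

theorem quadForm_neg (A : Matrix (Fin D) (Fin D) ℝ) (v : Vec D) :
    quadForm A (-v) = quadForm A v := by
  simp [quadForm, Matrix.mulVec_neg]

theorem IsMulOneAddOP.isLittleOP_sub {A : ℕ → Ω → Matrix (Fin D) (Fin D) ℝ}
    {B : Matrix (Fin D) (Fin D) ℝ} (h : IsMulOneAddOP μ A B) (i j : Fin D) :
    IsLittleOP μ fun k ω => A k ω i j - B i j := by
  obtain ⟨E, hE, hA⟩ := h
  have : ∀ k ω, A k ω i j - B i j = ∑ l, B i l * E k ω l j := fun k ω => by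
    rw [hA, mul_add, mul_one, Matrix.add_apply, add_sub_cancel_left, Matrix.mul_apply]
  simp only [this]
  exact IsLittleOP.sum _ fun l _ => (isBigOP_const (B i l)).mul_isLittleOP (hE l j)

theorem IsMulOneAddOP.isBigOP {A : ℕ → Ω → Matrix (Fin D) (Fin D) ℝ}
    {B : Matrix (Fin D) (Fin D) ℝ} (h : IsMulOneAddOP μ A B) (i j : Fin D) :
    IsBigOP μ fun k ω => A k ω i j := by
  simpa using (h.isLittleOP_sub i j).isBigOP.add (isBigOP_const (B i j))

/-- Quadratic forms depend continuously on matrix and argument, in the sense of `o_P`, as long as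
everything is bounded in probability. -/
theorem isLittleOP_quadForm_sub {A B : ℕ → Ω → Matrix (Fin D) (Fin D) ℝ} {U V : ℕ → Ω → Vec D}
    (hB : ∀ i j, IsBigOP μ fun k ω => B k ω i j)
    (hAB : ∀ i j, IsLittleOP μ fun k ω => A k ω i j - B k ω i j)
    (hU : ∀ i, IsBigOP μ fun k ω => U k ω i) (hVU : ∀ i, IsLittleOP μ fun k ω => V k ω i - U k ω i) :
    IsLittleOP μ fun k ω => quadForm (A k ω) (V k ω) - quadForm (B k ω) (U k ω) := by
  have hV : ∀ i, IsBigOP μ fun k ω => V k ω i := fun i => by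
    simpa using (hVU i).isBigOP.add (hU i)
  have hA : ∀ i j, IsBigOP μ fun k ω => A k ω i j := fun i j => by
    simpa using (hAB i j).isBigOP.add (hB i j)
  have h : ∀ k ω, quadForm (A k ω) (V k ω) - quadForm (B k ω) (U k ω) =
      ∑ i, ∑ j, ((A k ω i j * V k ω j) * (V k ω i - U k ω i) +
        (U k ω i * V k ω j) * (A k ω i j - B k ω i j) +
        (U k ω i * B k ω i j) * (V k ω j - U k ω j)) := fun k ω => by
    simp only [quadForm, dotProduct, Matrix.mulVec, Finset.mul_sum, ← Finset.sum_sub_distrib]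
    refine Finset.sum_congr rfl fun i _ => Finset.sum_congr rfl fun j _ => ?_
    ring
  simp only [h]
  exact IsLittleOP.sum _ fun i _ => IsLittleOP.sum _ fun j _ =>
    ((((hA i j).mul (hV j)).mul_isLittleOP (hVU i)).add
      (((hU i).mul (hV j)).mul_isLittleOP (hAB i j))).add
      (((hU i).mul (hB i j)).mul_isLittleOP (hVU j))

theorem isBigOP_quadForm {A : ℕ → Ω → Matrix (Fin D) (Fin D) ℝ} {V : ℕ → Ω → Vec D}
    (hA : ∀ i j, IsBigOP μ fun k ω => A k ω i j) (hV : ∀ i, IsBigOP μ fun k ω => V k ω i) :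
    IsBigOP μ fun k ω => quadForm (A k ω) (V k ω) := by
  simp only [quadForm, dotProduct, Matrix.mulVec]
  exact IsBigOP.sum _ fun i _ => (hV i).mul (IsBigOP.sum _ fun j _ => (hA i j).mul (hV j))

theorem abs_dotProduct_le (u : Vec D) (c : Fin D → ℝ) : |u.ofLp ⬝ᵥ c| ≤ ‖u‖ * ∑ j, |c j| := by
  rw [dotProduct, Finset.mul_sum]
  refine (Finset.abs_sum_le_sum_abs _ _).trans (Finset.sum_le_sum fun j _ => ?_)
  rw [abs_mul]
  exact mul_le_mul_of_nonneg_right (PiLp.norm_apply_le u j) (abs_nonneg _)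

theorem abs_dotProduct_sub_pow_le (x y : Vec D) (c : Fin D → ℝ) :
    |(x - y).ofLp ⬝ᵥ c| ^ 3 ≤ (∑ j, |c j|) ^ 3 * (4 * (‖x‖ ^ 3 + ‖y‖ ^ 3)) := by
  have hc : 0 ≤ ∑ j, |c j| := Finset.sum_nonneg fun j _ => abs_nonneg _
  have h₁ : |(x - y).ofLp ⬝ᵥ c| ≤ (‖x‖ + ‖y‖) * ∑ j, |c j| :=
    (abs_dotProduct_le _ _).trans (mul_le_mul_of_nonneg_right (norm_sub_le x y) hc)
  have h₂ : (‖x‖ + ‖y‖) ^ 3 ≤ 4 * (‖x‖ ^ 3 + ‖y‖ ^ 3) := by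
    have := add_pow_le (norm_nonneg x) (norm_nonneg y) 3
    norm_num at this
    exact this
  calc |(x - y).ofLp ⬝ᵥ c| ^ 3 ≤ ((‖x‖ + ‖y‖) * ∑ j, |c j|) ^ 3 := by gcongr
    _ = (∑ j, |c j|) ^ 3 * (‖x‖ + ‖y‖) ^ 3 := by ring
    _ ≤ _ := by gcongr

theorem norm_sampleMean_le {m : ℕ} (x : Fin m → Vec D) :
    ‖sampleMean x‖ ≤ (m : ℝ)⁻¹ * ∑ i, ‖x i‖ := by
  rw [sampleMean, norm_smul, Fintype.card_fin, Real.norm_of_nonneg (by positivity)]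
  gcongr
  exact norm_sum_le _ _

theorem norm_midMean_le {m₀ m₁ : ℕ} (x₀ : Fin m₀ → Vec D) (x₁ : Fin m₁ → Vec D) :
    ‖midMean x₀ x₁‖ ≤ (m₀ : ℝ)⁻¹ * ∑ i, ‖x₀ i‖ + (m₁ : ℝ)⁻¹ * ∑ i, ‖x₁ i‖ := by
  have h₀ := norm_sampleMean_le x₀
  have h₁ := norm_sampleMean_le x₁
  have h := norm_add_le (sampleMean x₀) (sampleMean x₁)
  rw [midMean, norm_smul, Real.norm_of_nonneg (by norm_num)]
  linarith [norm_nonneg (sampleMean x₀ + sampleMean x₁)]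

/-- Third moments bound the sum of cubed discriminant scores. Writing the discriminant as
`n^{-1/2} d` with `d` bounded in probability exhibits the rate `n^{-1/2}`. -/
theorem sum_abs_score_pow_le {m₀ m₁ : ℕ} (h₀ : 0 < m₀) (h₁ : 0 < m₁) (x₀ : Fin m₀ → Vec D)
    (x₁ : Fin m₁ → Vec D) {d : Fin D → ℝ}
    (hd : d = √((m₀ : ℝ) + m₁) • discriminant x₀ x₁) :
    ∑ i, |(pool x₀ x₁ i - midMean x₀ x₁).ofLp ⬝ᵥ discriminant x₀ x₁| ^ 3 ≤
      (√((m₀ : ℝ) + m₁))⁻¹ * ((∑ j, |d j|) ^ 3 * (4 *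
        ((m₀ : ℝ)⁻¹ * ∑ i, ‖x₀ i‖ ^ 3 + (m₁ : ℝ)⁻¹ * ∑ i, ‖x₁ i‖ ^ 3 +
          ((m₀ : ℝ)⁻¹ * ∑ i, ‖x₀ i‖ + (m₁ : ℝ)⁻¹ * ∑ i, ‖x₁ i‖) ^ 3))) := by
  have hm₀ : (0 : ℝ) < m₀ := by exact_mod_cast h₀
  have hm₁ : (0 : ℝ) < m₁ := by exact_mod_cast h₁
  set n : ℝ := (m₀ : ℝ) + m₁ with hn
  have hn0 : 0 < n := by positivity
  set M := midMean x₀ x₁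
  set c := discriminant x₀ x₁
  have hs : 0 < √n := Real.sqrt_pos.2 hn0
  have hdc : ∑ j, |d j| = √n * ∑ j, |c j| := by
    simp [hd, abs_mul, abs_of_pos hs, Finset.mul_sum]
  have hc : 0 ≤ ∑ j, |c j| := Finset.sum_nonneg fun j _ => abs_nonneg _
  set s₀ := ∑ i, ‖x₀ i‖ ^ 3 with hs₀
  set s₁ := ∑ i, ‖x₁ i‖ ^ 3 with hs₁
  have hs₀0 : 0 ≤ s₀ := Finset.sum_nonneg fun i _ => by positivity
  have hs₁0 : 0 ≤ s₁ := Finset.sum_nonneg fun i _ => by positivity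
  have hM := pow_le_pow_left₀ (norm_nonneg _) (norm_midMean_le x₀ x₁) 3
  set B := ((m₀ : ℝ)⁻¹ * ∑ i, ‖x₀ i‖ + (m₁ : ℝ)⁻¹ * ∑ i, ‖x₁ i‖) ^ 3
  have hsum : ∑ i, |(pool x₀ x₁ i - M).ofLp ⬝ᵥ c| ^ 3 ≤
      (∑ j, |c j|) ^ 3 * (4 * (s₀ + s₁ + n * ‖M‖ ^ 3)) := by
    refine (Finset.sum_le_sum fun i _ => abs_dotProduct_sub_pow_le _ _ _).trans_eq ?_
    rw [← Finset.mul_sum, ← Finset.mul_sum, Finset.sum_add_distrib]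
    simp [pool, hs₀, hs₁, hn]
  have hscale : s₀ + s₁ + n * ‖M‖ ^ 3 ≤ n * ((m₀ : ℝ)⁻¹ * s₀ + (m₁ : ℝ)⁻¹ * s₁ + B) := by
    have e₀ : s₀ ≤ n * ((m₀ : ℝ)⁻¹ * s₀) := by
      rw [← mul_assoc, ← div_eq_mul_inv]
      exact le_mul_of_one_le_left hs₀0 ((one_le_div hm₀).2 (by linarith))
    have e₁ : s₁ ≤ n * ((m₁ : ℝ)⁻¹ * s₁) := by
      rw [← mul_assoc, ← div_eq_mul_inv]
      exact le_mul_of_one_le_left hs₁0 ((one_le_div hm₁).2 (by linarith))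
    nlinarith [mul_le_mul_of_nonneg_left hM hn0.le]
  calc _ ≤ (∑ j, |c j|) ^ 3 * (4 * (s₀ + s₁ + n * ‖M‖ ^ 3)) := hsum
    _ ≤ (∑ j, |c j|) ^ 3 * (4 * (n * ((m₀ : ℝ)⁻¹ * s₀ + (m₁ : ℝ)⁻¹ * s₁ + B))) := by gcongr
    _ = _ := by
      rw [hdc]
      nth_rewrite 1 [← Real.sq_sqrt hn0.le]
      field_simp

end Remainder

/-! ### Asymptotics under separate sampling -/

section SeparateSampling

variable {Ω : Type*} [MeasurableSpace Ω] {μ : Measure Ω} {D : ℕ} {P₀ P₁ : Measure (Vec D)}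
  {m : Vec D} {S : Matrix (Fin D) (Fin D) ℝ} {X₀ X₁ : ℕ → Ω → Vec D} {n₀ n₁ : ℕ → ℕ} {p : ℝ}

/-- Separate sampling under the null hypothesis: two independent random samples of deterministic
sizes from populations with the same mean `m`, the same covariance matrix `S` and finite third
moments, the fraction of the second sample converging to `p ∈ (0, 1)`. -/
structure SeparateSampling (μ : Measure Ω) (P₀ P₁ : Measure (Vec D)) (m : Vec D)
    (S : Matrix (Fin D) (Fin D) ℝ) (X₀ X₁ : ℕ → Ω → Vec D) (n₀ n₁ : ℕ → ℕ) (p : ℝ) : Prop where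
  mean₀ : ∫ x, x ∂P₀ = m
  mean₁ : ∫ x, x ∂P₁ = m
  cov₀ : covMatrix P₀ = S
  cov₁ : covMatrix P₁ = S
  third₀ : Integrable (fun x => ‖x‖ ^ 3) P₀
  third₁ : Integrable (fun x => ‖x‖ ^ 3) P₁
  law₀ : ∀ i, HasLaw (X₀ i) P₀ μ
  law₁ : ∀ i, HasLaw (X₁ i) P₁ μ
  indep : iIndepFun (Sum.elim X₀ X₁) μ
  size : Tendsto (fun k => n₀ k + n₁ k) atTop atTop
  p_pos : 0 < p
  p_lt_one : p < 1
  tendsto_prop₁ : Tendsto (fun k => prop₁ (n₀ k) (n₁ k)) atTop (𝓝 p)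

namespace SeparateSampling

variable (h : SeparateSampling μ P₀ P₁ m S X₀ X₁ n₀ n₁ p)
include h

theorem eventually_size_pos : ∀ᶠ k in atTop, (0 : ℝ) < (n₀ k : ℝ) + n₁ k := by
  filter_upwards [h.size.eventually_gt_atTop 0] with k hk
  exact_mod_cast hk

theorem tendsto_size : Tendsto (fun k => (n₀ k : ℝ) + n₁ k) atTop atTop := by
  simpa only [Function.comp_def, Nat.cast_add] using
    (tendsto_natCast_atTop_atTop (R := ℝ)).comp h.size

theorem tendsto_prop₀ : Tendsto (fun k => prop₀ (n₀ k) (n₁ k)) atTop (𝓝 (1 - p)) := by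
  refine (h.tendsto_prop₁.const_sub 1).congr' ?_
  filter_upwards [h.eventually_size_pos] with k hk
  unfold prop₀ prop₁
  field_simp
  ring

theorem tendsto_n₁ : Tendsto n₁ atTop atTop := by
  rw [← tendsto_natCast_atTop_iff (R := ℝ)]
  refine (h.tendsto_prop₁.pos_mul_atTop h.p_pos h.tendsto_size).congr' ?_
  filter_upwards [h.eventually_size_pos] with k hk
  exact div_mul_cancel₀ _ hk.ne'

theorem tendsto_n₀ : Tendsto n₀ atTop atTop := by
  rw [← tendsto_natCast_atTop_iff (R := ℝ)]
  refine (h.tendsto_prop₀.pos_mul_atTop (sub_pos.2 h.p_lt_one) h.tendsto_size).congr' ?_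
  filter_upwards [h.eventually_size_pos] with k hk
  exact div_mul_cancel₀ _ hk.ne'

theorem eventually_pos : ∀ᶠ k in atTop, 0 < n₀ k ∧ 0 < n₁ k :=
  (h.tendsto_n₀.eventually_gt_atTop 0).and (h.tendsto_n₁.eventually_gt_atTop 0)

theorem indep₀ : iIndepFun X₀ μ := h.indep.precomp (g := Sum.inl) Sum.inl_injective

theorem indep₁ : iIndepFun X₁ μ := h.indep.precomp (g := Sum.inr) Sum.inr_injective

theorem eventually_sqrt_smul_mean_sub : ∀ᶠ k in atTop, ∀ ω,
    √((n₀ k : ℝ) + n₁ k) • (sampleMean (firstN X₁ (n₁ k) ω) - sampleMean (firstN X₀ (n₀ k) ω)) =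
      (√(prop₁ (n₀ k) (n₁ k)))⁻¹ • stdSum X₁ m (n₁ k) ω -
        (√(prop₀ (n₀ k) (n₁ k)))⁻¹ • stdSum X₀ m (n₀ k) ω := by
  filter_upwards [h.eventually_pos] with k ⟨hk₀, hk₁⟩ ω
  rw [← sub_sub_sub_cancel_right _ _ m, sampleMean_firstN_sub m hk₀, sampleMean_firstN_sub m hk₁,
    smul_sub, smul_smul, smul_smul, prop₀, prop₁, Real.sqrt_div (Nat.cast_nonneg _),
    Real.sqrt_div (Nat.cast_nonneg _), inv_div, inv_div, div_eq_mul_inv, div_eq_mul_inv]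

theorem isBigOP_stdSum₀ [IsProbabilityMeasure μ] [IsProbabilityMeasure P₀] (j : Fin D) :
    IsBigOP μ fun k ω => stdSum X₀ m (n₀ k) ω j :=
  isBigOP_stdSum h.law₀ h.indep₀ (memLp_two_of_third h.third₀) h.mean₀ n₀ j

theorem isBigOP_stdSum₁ [IsProbabilityMeasure μ] [IsProbabilityMeasure P₁] (j : Fin D) :
    IsBigOP μ fun k ω => stdSum X₁ m (n₁ k) ω j :=
  isBigOP_stdSum h.law₁ h.indep₁ (memLp_two_of_third h.third₁) h.mean₁ n₁ j

theorem isBigOP_averages [IsProbabilityMeasure P₀] [IsProbabilityMeasure P₁] :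
    IsBigOP μ fun k ω =>
    (n₀ k : ℝ)⁻¹ * ∑ i, ‖firstN X₀ (n₀ k) ω i‖ ^ 3 + (n₁ k : ℝ)⁻¹ * ∑ i, ‖firstN X₁ (n₁ k) ω i‖ ^ 3 +
      ((n₀ k : ℝ)⁻¹ * ∑ i, ‖firstN X₀ (n₀ k) ω i‖ +
        (n₁ k : ℝ)⁻¹ * ∑ i, ‖firstN X₁ (n₁ k) ω i‖) ^ 3 := by
  have h₀ := isBigOP_average h.law₀ h.third₀ (fun x => by positivity) n₀
  have h₁ := isBigOP_average h.law₁ h.third₁ (fun x => by positivity) n₁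
  have h₂ := isBigOP_average h.law₀
    ((memLp_two_of_third h.third₀).integrable (by norm_num)).norm (fun x => by positivity) n₀
  have h₃ := isBigOP_average h.law₁
    ((memLp_two_of_third h.third₁).integrable (by norm_num)).norm (fun x => by positivity) n₁
  simp only [Finset.sum_range] at h₀ h₁ h₂ h₃
  exact (h₀.add h₁).add ((h₂.add h₃).pow 3)

variable [IsProbabilityMeasure μ] [IsProbabilityMeasure P₀] [IsProbabilityMeasure P₁]

theorem isBigOP_sqrt_smul_mean_sub (j : Fin D) : IsBigOP μ fun k ω =>
    (√((n₀ k : ℝ) + n₁ k) •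
      (sampleMean (firstN X₁ (n₁ k) ω) - sampleMean (firstN X₀ (n₀ k) ω))) j := by
  have hlim₁ := (h.tendsto_prop₁.sqrt).inv₀ (Real.sqrt_pos.2 h.p_pos).ne'
  have hlim₀ := (h.tendsto_prop₀.sqrt).inv₀ (Real.sqrt_pos.2 (sub_pos.2 h.p_lt_one)).ne'
  refine (((IsBigOP.of_tendsto hlim₁).mul (h.isBigOP_stdSum₁ j)).sub
    ((IsBigOP.of_tendsto hlim₀).mul (h.isBigOP_stdSum₀ j))).mono ?_
  filter_upwards [h.eventually_sqrt_smul_mean_sub] with k hk ω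
  rw [hk ω]
  rfl

/-- The error of replacing the logistic function by its linear part in the LDA statistic. -/
theorem isLittleOP_linearization
    (hS : IsMulOneAddOP μ
      (fun k ω => (combinedCov (firstN X₀ (n₀ k) ω) (firstN X₁ (n₁ k) ω))⁻¹) S⁻¹) :
    IsLittleOP μ fun k ω =>
      ((n₀ k : ℝ) + n₁ k) * statLDA (firstN X₀ (n₀ k) ω) (firstN X₁ (n₁ k) ω) -
        (prop₀ (n₀ k) (n₁ k) * prop₁ (n₀ k) (n₁ k)) ^ 2 *
        (((n₀ k : ℝ) + n₁ k) *
          quadForm (combinedCov (firstN X₀ (n₀ k) ω) (firstN X₁ (n₁ k) ω))⁻¹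
            (sampleMean (firstN X₁ (n₁ k) ω) - sampleMean (firstN X₀ (n₀ k) ω)) +
        ((n₀ k : ℝ) + n₁ k) * (prop₁ (n₀ k) (n₁ k) - 1 / 2) ^ 2 *
          quadForm (combinedCov (firstN X₀ (n₀ k) ω) (firstN X₁ (n₁ k) ω))⁻¹
            (sampleMean (firstN X₁ (n₁ k) ω) - sampleMean (firstN X₀ (n₀ k) ω)) ^ 2) := by
  have hd : ∀ i, IsBigOP μ fun k ω =>
      (√((n₀ k : ℝ) + n₁ k) • discriminant (firstN X₀ (n₀ k) ω) (firstN X₁ (n₁ k) ω)) i :=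
    fun i => by
    have := IsBigOP.sum Finset.univ fun j _ =>
      (hS.isBigOP i j).mul (h.isBigOP_sqrt_smul_mean_sub j)
    refine this.mono (.of_forall fun k ω => le_of_eq (congrArg abs ?_))
    simp only [discriminant, ← Matrix.mulVec_smul]
    rfl
  have hbound := (((IsBigOP.sum Finset.univ fun i _ => (hd i).abs).pow 3).mul
    ((isBigOP_const 4).mul h.isBigOP_averages)).mul_isLittleOP
    (.of_tendsto (tendsto_inv_atTop_zero.comp (Real.tendsto_sqrt_atTop.comp h.tendsto_size)))
  refine ((isBigOP_const 63).mul_isLittleOP hbound).mono ?_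
  filter_upwards [h.eventually_pos] with k ⟨hk₀, hk₁⟩ ω
  refine (abs_statLDA_sub_le _ _ hk₀ hk₁).trans (le_trans ?_ (le_abs_self _))
  refine mul_le_mul_of_nonneg_left ?_ (by norm_num)
  refine (sum_abs_score_pow_le hk₀ hk₁ _ _ rfl).trans_eq ?_
  rw [mul_comm]
  rfl

theorem isLittleOP_statLDA_sub
    (hSp : IsMulOneAddOP μ
      (fun k ω => (pooledCov (firstN X₀ (n₀ k) ω) (firstN X₁ (n₁ k) ω))⁻¹) S⁻¹)
    (hS : IsMulOneAddOP μ
      (fun k ω => (combinedCov (firstN X₀ (n₀ k) ω) (firstN X₁ (n₁ k) ω))⁻¹) S⁻¹) :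
    IsLittleOP μ fun k ω =>
      ((n₀ k : ℝ) + n₁ k) * statLDA (firstN X₀ (n₀ k) ω) (firstN X₁ (n₁ k) ω) -
        ((n₀ k : ℝ) + n₁ k) * prop₀ (n₀ k) (n₁ k) ^ 2 * prop₁ (n₀ k) (n₁ k) ^ 2 *
          quadForm (pooledCov (firstN X₀ (n₀ k) ω) (firstN X₁ (n₁ k) ω))⁻¹
            (sampleMean (firstN X₀ (n₀ k) ω) - sampleMean (firstN X₁ (n₁ k) ω)) := by
  have hZ := h.isBigOP_sqrt_smul_mean_sub
  -- replacing `S⁻¹` by `S_p⁻¹` in the leading quadratic form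
  have hreplace := isLittleOP_quadForm_sub hSp.isBigOP
    (fun i j => ((hS.isLittleOP_sub i j).sub (hSp.isLittleOP_sub i j)).congr
      (.of_forall fun k ω => (sub_sub_sub_cancel_right _ _ _).symm)) hZ
    (fun i => isLittleOP_zero.congr (.of_forall fun k ω => sub_self _))
  -- the quartic term from the parallel axis theorem is of order `1 / n`
  have hquartic := ((isBigOP_quadForm hS.isBigOP hZ).pow 2).mul_isLittleOP
    (.of_tendsto (tendsto_inv_atTop_zero.comp h.tendsto_size))
  have hc : IsBigOP μ fun k _ => (prop₀ (n₀ k) (n₁ k) * prop₁ (n₀ k) (n₁ k)) ^ 2 :=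
    .of_tendsto ((h.tendsto_prop₀.mul h.tendsto_prop₁).pow 2)
  have hc' : IsBigOP μ fun k _ => (prop₀ (n₀ k) (n₁ k) * prop₁ (n₀ k) (n₁ k)) ^ 2 *
      (prop₁ (n₀ k) (n₁ k) - 1 / 2) ^ 2 :=
    hc.mul (.of_tendsto ((h.tendsto_prop₁.sub_const (1 / 2)).pow 2))
  refine ((h.isLittleOP_linearization hS).add ((hc.mul_isLittleOP hreplace).add
    (hc'.mul_isLittleOP hquartic))).congr ?_
  filter_upwards [h.eventually_size_pos] with k hk ω
  rw [← neg_sub (sampleMean (firstN X₁ (n₁ k) ω)), quadForm_neg]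
  simp only [quadForm_smul, Real.sq_sqrt hk.le, Function.comp_apply]
  field_simp
  ring

theorem isLittleOP_statLDA_sub_hotelling
    (hSp : IsMulOneAddOP μ
      (fun k ω => (pooledCov (firstN X₀ (n₀ k) ω) (firstN X₁ (n₁ k) ω))⁻¹) S⁻¹)
    (hS : IsMulOneAddOP μ
      (fun k ω => (combinedCov (firstN X₀ (n₀ k) ω) (firstN X₁ (n₁ k) ω))⁻¹) S⁻¹) :
    IsLittleOP μ fun k ω =>
      ((n₀ k : ℝ) + n₁ k) * (prop₀ (n₀ k) (n₁ k))⁻¹ * (prop₁ (n₀ k) (n₁ k))⁻¹ *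
        statLDA (firstN X₀ (n₀ k) ω) (firstN X₁ (n₁ k) ω) -
          hotelling (firstN X₀ (n₀ k) ω) (firstN X₁ (n₁ k) ω) := by
  have hc : IsBigOP μ fun k _ => (prop₀ (n₀ k) (n₁ k))⁻¹ * (prop₁ (n₀ k) (n₁ k))⁻¹ :=
    .of_tendsto ((h.tendsto_prop₀.inv₀ (sub_pos.2 h.p_lt_one).ne').mul
      (h.tendsto_prop₁.inv₀ h.p_pos.ne'))
  refine (hc.mul_isLittleOP (h.isLittleOP_statLDA_sub hSp hS)).congr ?_
  filter_upwards [h.eventually_pos] with k ⟨hk₀, hk₁⟩ ω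
  have h₀ : (0 : ℝ) < n₀ k := by exact_mod_cast hk₀
  have h₁ : (0 : ℝ) < n₁ k := by exact_mod_cast hk₁
  rw [hotelling, prop₀, prop₁]
  field_simp

theorem tendstoInDistribution_hotelling (hSunit : IsUnit S.det)
    (hSp : IsMulOneAddOP μ
      (fun k ω => (pooledCov (firstN X₀ (n₀ k) ω) (firstN X₁ (n₁ k) ω))⁻¹) S⁻¹) :
    TendstoInDistribution
      (fun k ω => hotelling (firstN X₀ (n₀ k) ω) (firstN X₁ (n₁ k) ω)) atTop
      id (fun _ => μ) (chiSquared D) := by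
  have hq : 0 ≤ 1 - p := (sub_pos.2 h.p_lt_one).le
  have hclt := tendstoInDistribution_quadForm_stdSum h.law₀ h.law₁ h.indep
    (memLp_two_of_third h.third₀) (memLp_two_of_third h.third₁) h.mean₀ h.mean₁ h.cov₀ h.cov₁
    hSunit h.tendsto_n₀ h.tendsto_n₁ (a := -√p) (b := √(1 - p))
    (by rw [neg_sq, Real.sq_sqrt h.p_pos.le, Real.sq_sqrt hq]; ring)
  refine tendstoInDistribution_of_tendstoInMeasure_sub _ _ hclt ?_ fun k => ?_
  · have hU : ∀ i, IsBigOP μ fun k ω =>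
        ((-√p) • stdSum X₀ m (n₀ k) ω + √(1 - p) • stdSum X₁ m (n₁ k) ω) i := fun i =>
      ((isBigOP_const (-√p)).mul (h.isBigOP_stdSum₀ i)).add
        ((isBigOP_const (√(1 - p))).mul (h.isBigOP_stdSum₁ i))
    -- the class proportions are replaced by their limits
    have hVU : ∀ i, IsLittleOP μ fun k ω =>
        ((-√(prop₁ (n₀ k) (n₁ k))) • stdSum X₀ m (n₀ k) ω +
          √(prop₀ (n₀ k) (n₁ k)) • stdSum X₁ m (n₁ k) ω) i -
        ((-√p) • stdSum X₀ m (n₀ k) ω + √(1 - p) • stdSum X₁ m (n₁ k) ω) i := fun i => by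
      have hlim₁ : Tendsto (fun k => √p - √(prop₁ (n₀ k) (n₁ k))) atTop (𝓝 0) := by
        simpa using h.tendsto_prop₁.sqrt.const_sub (√p)
      have hlim₀ : Tendsto (fun k => √(prop₀ (n₀ k) (n₁ k)) - √(1 - p)) atTop (𝓝 0) := by
        simpa using h.tendsto_prop₀.sqrt.sub_const (√(1 - p))
      refine (((h.isBigOP_stdSum₀ i).mul_isLittleOP (.of_tendsto hlim₁)).add
        ((h.isBigOP_stdSum₁ i).mul_isLittleOP (.of_tendsto hlim₀))).congr
        (.of_forall fun k ω => ?_)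
      simp only [PiLp.add_apply, PiLp.smul_apply, smul_eq_mul]
      ring
    have hmain := isLittleOP_quadForm_sub (fun i j => isBigOP_const (S⁻¹ i j))
      hSp.isLittleOP_sub hU hVU
    refine hmain.congr ?_
    filter_upwards [h.eventually_sqrt_smul_mean_sub, h.eventually_pos] with k hk ⟨hk₀, hk₁⟩ ω
    have h₀ : (0 : ℝ) < prop₀ (n₀ k) (n₁ k) := prop₀_pos hk₀
    have h₁ : (0 : ℝ) < prop₁ (n₀ k) (n₁ k) := prop₁_pos hk₁
    have hn : (0 : ℝ) < (n₀ k : ℝ) + n₁ k := by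
      have : (0 : ℝ) < n₀ k := by exact_mod_cast hk₀
      positivity
    have hV : (-√(prop₁ (n₀ k) (n₁ k))) • stdSum X₀ m (n₀ k) ω +
        √(prop₀ (n₀ k) (n₁ k)) • stdSum X₁ m (n₁ k) ω =
        (√(prop₀ (n₀ k) (n₁ k)) * √(prop₁ (n₀ k) (n₁ k)) * √((n₀ k : ℝ) + n₁ k)) •
          (sampleMean (firstN X₁ (n₁ k) ω) - sampleMean (firstN X₀ (n₀ k) ω)) := by
      have e₀ := (Real.sqrt_pos.2 h₀).ne'
      have e₁ := (Real.sqrt_pos.2 h₁).ne'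
      rw [mul_smul, hk ω, smul_sub, smul_smul, smul_smul, mul_inv_cancel_right₀ e₁, mul_right_comm,
        mul_inv_cancel₀ e₀, one_mul, neg_smul]
      abel
    have hH : hotelling (firstN X₀ (n₀ k) ω) (firstN X₁ (n₁ k) ω) =
        quadForm (pooledCov (firstN X₀ (n₀ k) ω) (firstN X₁ (n₁ k) ω))⁻¹
          ((-√(prop₁ (n₀ k) (n₁ k))) • stdSum X₀ m (n₀ k) ω +
            √(prop₀ (n₀ k) (n₁ k)) • stdSum X₁ m (n₁ k) ω) := by
      rw [hV, quadForm_smul, hotelling, ← neg_sub (sampleMean (firstN X₁ (n₁ k) ω)), quadForm_neg,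
        mul_pow, mul_pow, Real.sq_sqrt h₀.le, Real.sq_sqrt h₁.le, Real.sq_sqrt hn.le, prop₀, prop₁]
      congr 1
      field_simp
    exact congrArg (· - _) hH
  · exact aemeasurable_comp_firstN measurable_hotelling
      (fun i => (h.law₀ i).aemeasurable) fun i => (h.law₁ i).aemeasurable

theorem tendstoInDistribution_statLDA (hSunit : IsUnit S.det)
    (hSp : IsMulOneAddOP μ
      (fun k ω => (pooledCov (firstN X₀ (n₀ k) ω) (firstN X₁ (n₁ k) ω))⁻¹) S⁻¹)
    (hS : IsMulOneAddOP μ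
      (fun k ω => (combinedCov (firstN X₀ (n₀ k) ω) (firstN X₁ (n₁ k) ω))⁻¹) S⁻¹) :
    TendstoInDistribution
      (fun k ω => ((n₀ k : ℝ) + n₁ k) * (prop₀ (n₀ k) (n₁ k))⁻¹ * (prop₁ (n₀ k) (n₁ k))⁻¹ *
        statLDA (firstN X₀ (n₀ k) ω) (firstN X₁ (n₁ k) ω)) atTop
      id (fun _ => μ) (chiSquared D) := by
  refine tendstoInDistribution_of_tendstoInMeasure_sub _ _
    (h.tendstoInDistribution_hotelling hSunit hSp)
    (h.isLittleOP_statLDA_sub_hotelling hSp hS) fun k => ?_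
  have hT : AEMeasurable (fun ω => statLDA (firstN X₀ (n₀ k) ω) (firstN X₁ (n₁ k) ω)) μ :=
    aemeasurable_comp_firstN measurable_statLDA
      (fun i => (h.law₀ i).aemeasurable) fun i => (h.law₁ i).aemeasurable
  exact hT.const_mul _

end SeparateSampling
end SeparateSampling

end LDATwoSample

theorem theorem1 {Ω : Type*} [MeasurableSpace Ω] (μ : Measure Ω) [IsProbabilityMeasure μ]
    {D : ℕ}
    -- the two populations: means, common nonsingular covariance matrix, finite third moments
    (P₀ P₁ : Measure (LDATwoSample.Vec D)) [IsProbabilityMeasure P₀] [IsProbabilityMeasure P₁]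
    (μ₀ μ₁ : LDATwoSample.Vec D) (Sig : Matrix (Fin D) (Fin D) ℝ)
    (hmean₀ : ∫ x, x ∂P₀ = μ₀) (hmean₁ : ∫ x, x ∂P₁ = μ₁)
    (hcov₀ : LDATwoSample.covMatrix P₀ = Sig) (hcov₁ : LDATwoSample.covMatrix P₁ = Sig)
    (hSig : IsUnit Sig.det)
    (hthird₀ : Integrable (fun x => ‖x‖ ^ 3) P₀) (hthird₁ : Integrable (fun x => ‖x‖ ^ 3) P₁)
    -- the observations: mutually independent, `X₀ i ∼ P₀` and `X₁ i ∼ P₁`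
    (X₀ X₁ : ℕ → Ω → LDATwoSample.Vec D)
    (hlaw₀ : ∀ i, HasLaw (X₀ i) P₀ μ) (hlaw₁ : ∀ i, HasLaw (X₁ i) P₁ μ)
    (hindep : iIndepFun (Sum.elim X₀ X₁) μ)
    -- separate sampling: deterministic sample sizes, with `n = n₀ + n₁ → ∞`, `n₁ / n → p ∈ (0, 1)`
    (n₀ n₁ : ℕ → ℕ) (hn : Tendsto (fun k => n₀ k + n₁ k) atTop atTop)
    (p : ℝ) (hp0 : 0 < p) (hp1 : p < 1)
    (hprop : Tendsto (fun k => LDATwoSample.prop₁ (n₀ k) (n₁ k)) atTop (𝓝 p))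
    -- `S_p⁻¹ = Σ⁻¹ (1 + o_P(1))` and `S⁻¹ = Σ⁻¹ (1 + o_P(1))`
    (hSp : LDATwoSample.IsMulOneAddOP μ
      (fun k ω => (LDATwoSample.pooledCov (LDATwoSample.firstN X₀ (n₀ k) ω)
        (LDATwoSample.firstN X₁ (n₁ k) ω))⁻¹) Sig⁻¹)
    (hS : LDATwoSample.IsMulOneAddOP μ
      (fun k ω => (LDATwoSample.combinedCov (LDATwoSample.firstN X₀ (n₀ k) ω)
        (LDATwoSample.firstN X₁ (n₁ k) ω))⁻¹) Sig⁻¹)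
    -- the null hypothesis
    (hnull : μ₀ = μ₁) :
    let n : ℕ → ℝ := fun k => (n₀ k : ℝ) + n₁ k
    let π₀ : ℕ → ℝ := fun k => LDATwoSample.prop₀ (n₀ k) (n₁ k)
    let π₁ : ℕ → ℝ := fun k => LDATwoSample.prop₁ (n₀ k) (n₁ k)
    let x₀ : (k : ℕ) → Ω → Fin (n₀ k) → LDATwoSample.Vec D :=
      fun k => LDATwoSample.firstN X₀ (n₀ k)
    let x₁ : (k : ℕ) → Ω → Fin (n₁ k) → LDATwoSample.Vec D :=
      fun k => LDATwoSample.firstN X₁ (n₁ k)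
    let T : ℕ → Ω → ℝ := fun k ω => LDATwoSample.statLDA (x₀ k ω) (x₁ k ω)
    let H : ℕ → Ω → ℝ := fun k ω => LDATwoSample.hotelling (x₀ k ω) (x₁ k ω)
    LDATwoSample.IsLittleOP μ (fun k ω =>
        n k * T k ω - n k * π₀ k ^ 2 * π₁ k ^ 2 *
          LDATwoSample.quadForm (LDATwoSample.pooledCov (x₀ k ω) (x₁ k ω))⁻¹
            (LDATwoSample.sampleMean (x₀ k ω) - LDATwoSample.sampleMean (x₁ k ω))) ∧
      LDATwoSample.IsLittleOP μ (fun k ω =>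
        n k * (π₀ k)⁻¹ * (π₁ k)⁻¹ * T k ω - H k ω) ∧
      TendstoInDistribution (fun k ω => n k * (π₀ k)⁻¹ * (π₁ k)⁻¹ * T k ω) atTop
        id (fun _ => μ) (LDATwoSample.chiSquared D) ∧
      TendstoInDistribution H atTop id (fun _ => μ) (LDATwoSample.chiSquared D) := by
  have h : LDATwoSample.SeparateSampling μ P₀ P₁ μ₀ Sig X₀ X₁ n₀ n₁ p :=
    ⟨hmean₀, hmean₁.trans hnull.symm, hcov₀, hcov₁, hthird₀, hthird₁, hlaw₀, hlaw₁, hindep, hn,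
      hp0, hp1, hprop⟩
  exact ⟨h.isLittleOP_statLDA_sub hSp hS, h.isLittleOP_statLDA_sub_hotelling hSp hS,
    h.tendstoInDistribution_statLDA hSig hSp hS, h.tendstoInDistribution_hotelling hSig hSp⟩
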